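/- Let $n \ge 0$ be an integer. A cube in $\mathbb{R}^n$ means a cube with sides parallel to the coordinate axes; two cubes $Q, Q'$ of the same sidelength $l(Q)=l(Q')>0$ are consecutive if the intersection of their closures is a face (of dimension $n-1$) of each of them. For a Lebesgue measurable set $A\subset\mathbb{R}^n$ write $D_A(Q)=|A\cap Q|/|Q|$. The set $A$ is called smooth if $$\lim_{\delta\to0^+}\ \sup |D_A(Q)-D_A(Q')| = 0,$$ where the supremum is over all pairs of consecutive cubes $Q,Q'$ with $l(Q)=l(Q')\le\delta$. Given a continuous nondecreasing function $\omega:[0,1]\to[0,\infty)$ with $\omega(0)=0$, the set $A$ is called $\omega$-smooth if $|D_A(Q)-D_A(Q')|\le\omega(l(Q))$ for every pair of consecutive cubes $Q,Q'$ with $l(Q)=l(Q')\le 1$. Proposition. 1. If $\varphi:\mathbb{R}^n\to\mathbb{R}^n$ is linear and $A\subset\mathbb{R}^n$ is smooth, then $\varphi(A)$ is smooth. 2. There is a constant $C=C(n)>0$ such that, for every rotation $\varphi$ of $\mathbb{R}^n$ (a linear isometry of determinant $1$), every $\omega$ as above and every $\omega$-smooth set $A\subset\mathbb{R}^n$, the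 set $\varphi(A)$ is $C\omega$-smooth. 3. Let $\lambda\in\mathbb{R}\setminus\{0\}$, and let $\varphi:\mathbb{R}^n\to\mathbb{R}^n$ be the dilation with parameter $\lambda$ in the direction of one coordinate axis, i.e. the linear map that multiplies the $i$-th coordinate by $\lambda$ and fixes all the other coordinates, for some $1\le i\le n$. For every $\omega$ as above and every $\omega$-smooth set $A\subset\mathbb{R}^n$, the set $\varphi(A)$ is $C(\lambda)\,\omega$-smooth with $C(\lambda)=4\left(|\lambda|+1/|\lambda|\right)$. -/

import Mathlib

open MeasureTheory Set Filter Topology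

noncomputable section

namespace SmoothSet

/-- The closed cube in `ℝⁿ` with sides parallel to the axes, lower corner `a` and sidelength `l`. -/
def cube {n : ℕ} (a : EuclideanSpace ℝ (Fin n)) (l : ℝ) : Set (EuclideanSpace ℝ (Fin n)) :=
  {x | ∀ i, a i ≤ x i ∧ x i ≤ a i + l}

/-- `F` is one of the `2n` faces (of codimension one) of the cube `cube a l`. -/
def IsFace {n : ℕ} (F : Set (EuclideanSpace ℝ (Fin n))) (a : EuclideanSpace ℝ (Fin n))
    (l : ℝ) : Prop :=
  ∃ i, F = {x ∈ cube a l | x i = a i} ∨ F = {x ∈ cube a l | x i = a i + l}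

/-- The cubes `cube a l` and `cube a' l`, of the same sidelength `l`, are consecutive: their
intersection is a face of both. -/
def Consecutive {n : ℕ} (a a' : EuclideanSpace ℝ (Fin n)) (l : ℝ) : Prop :=
  IsFace (cube a l ∩ cube a' l) a l ∧ IsFace (cube a l ∩ cube a' l) a' l

/-- The density `D(Q) = |A ∩ Q| / |Q|` of `A` in `Q`. -/
def density {n : ℕ} (A Q : Set (EuclideanSpace ℝ (Fin n))) : ℝ :=
  volume.real (A ∩ Q) / volume.real Q

/-- The supremum of `|D(Q) - D(Q')|` over all pairs of consecutive cubes of the same sidelength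
`l(Q) = l(Q') ≤ δ`. (All these numbers lie in `[0, 1]`.) -/
def oscillation {n : ℕ} (A : Set (EuclideanSpace ℝ (Fin n))) (δ : ℝ) : ℝ :=
  sSup {r | ∃ (l : ℝ) (a a' : EuclideanSpace ℝ (Fin n)), 0 < l ∧ l ≤ δ ∧ Consecutive a a' l ∧
    r = |density A (cube a l) - density A (cube a' l)|}

/-- A Lebesgue measurable set `A ⊆ ℝⁿ` is smooth if
`sup |D(Q) - D(Q')| → 0` as `δ → 0⁺`, the supremum being over all pairs of consecutive cubes of
the same sidelength at most `δ`. (`NullMeasurableSet` for `volume` is Lebesgue measurability.) -/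
def IsSmooth {n : ℕ} (A : Set (EuclideanSpace ℝ (Fin n))) : Prop :=
  NullMeasurableSet A volume ∧ Tendsto (oscillation A) (𝓝[>] 0) (𝓝 0)

/-- `ω` restricts to a continuous increasing (i.e. nondecreasing) function `[0, 1] → [0, ∞)`
with `ω(0) = 0`. -/
structure IsModulus (ω : ℝ → ℝ) : Prop where
  mapsTo : MapsTo ω (Icc 0 1) (Ici 0)
  continuousOn : ContinuousOn ω (Icc 0 1)
  monotoneOn : MonotoneOn ω (Icc 0 1)
  zero : ω 0 = 0

/-- A Lebesgue measurable set `A ⊆ ℝⁿ` is `ω`-smooth if `|D(Q) - D(Q')| ≤ ω(l(Q))` for any pair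
of consecutive cubes of the same sidelength `l(Q) = l(Q')` (in the domain `[0, 1]` of `ω`). -/
def IsOmegaSmooth {n : ℕ} (ω : ℝ → ℝ) (A : Set (EuclideanSpace ℝ (Fin n))) : Prop :=
  NullMeasurableSet A volume ∧
    ∀ (l : ℝ) (a a' : EuclideanSpace ℝ (Fin n)), 0 < l → l ≤ 1 → Consecutive a a' l →
      |density A (cube a l) - density A (cube a' l)| ≤ ω l

/-- A rotation of `ℝⁿ`: a linear isometry of determinant one. -/
def IsRotation {n : ℕ} (φ : EuclideanSpace ℝ (Fin n) →ₗ[ℝ] EuclideanSpace ℝ (Fin n)) : Prop :=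
  (∀ x, ‖φ x‖ = ‖x‖) ∧ LinearMap.det φ = 1

/-- The dilation with parameter `lam` in the direction of the `i`-th coordinate axis: it
multiplies the `i`-th coordinate by `lam` and leaves the other coordinates unchanged. -/
def dilation {n : ℕ} (i : Fin n) (lam : ℝ) :
    EuclideanSpace ℝ (Fin n) →ₗ[ℝ] EuclideanSpace ℝ (Fin n) where
  toFun x := WithLp.toLp 2 fun j => if j = i then lam * x j else x j
  map_add' x y := by
    ext j
    by_cases h : j = i <;> simp [h, mul_add]
  map_smul' c x := by
    ext j
    by_cases h : j = i <;> simp [h, mul_left_comm]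

end SmoothSet

end

/-!
Linear images of smooth sets are smooth, with quantitative versions for rotations and for dilations
along an axis. Write `μ` for the restriction of Lebesgue measure to the set `A`. If `φ` is
invertible, the density of `φ '' A` in a cube `Q` is the quotient of the `μ`-mass and the volume of
`φ ⁻¹' Q`, so everything is a statement about the mass that `μ` gives to preimages of cubes, and the
only information on `μ` is that its masses on adjacent cubes of sidelength `s ≤ l` differ by at most
`w * s ^ n` (`AdjacentBound`).

For a general invertible `φ`, the region `R = φ ⁻¹' Q` has a boundary layer of width `s` whose
relative volume is `O(s / l)`. Exhaust `R` by the dyadic cells of sidelength `l / 2 ^ k` contained in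
`R`. The density of `A` in a cell of level `k` differs by `O((k + 1) * w)` from the density in
a fixed reference cell of level `0`, and the cells that appear only at level `k + 1` have relative volume
`O(2 ^ (-k))`. As `∑ k / 2 ^ k` converges, the density of `A` in `R` differs from the reference
density by `O(w)` (`abs_measureReal_sub_mul_le_of_thin_boundary`). Consecutive cubes share a point,
whose preimage gives a reference cell for both (`abs_density_image_sub_le`). The constant depends only
on `n` and on bounds for `φ` and its inverse, hence only on `n` for rotations. If `φ` is singular, the
image is a null set.

For a dilation along the `i`-th axis this argument would give a constant depending on `n`. There the
preimage of a cube is a box of side `l / |lam|` in direction `i` and side `l` in the others. Let `F` be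
the distribution function, along the `i`-th axis, of the mass in a column of width `l`. A slice of
thickness `l / 2 ^ k` consists of cubes of that sidelength, so the second differences of `F` with these
steps satisfy a Zygmund-type bound free of `n`
(`abs_columnMass_second_difference_le`). Hence `F` is close to its chords over intervals of length `l`
(`abs_sub_chord_le`). This controls second differences of `F` with arbitrary step, which compare boxes
adjacent in direction `i`. For boxes adjacent in another direction one applies the chord estimate to
the difference of the two distribution functions, whose increments over steps of length `l` compare
adjacent cubes.
-/

noncomputable section

namespace SmoothSet

/-! ### Half-open boxes and grids -/

/-- The half-open box with lower corner `a` and side lengths `b`. It differs from the closed box by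
a null set, and half-open boxes tile. -/
def icoBox {n : ℕ} (a b : Fin n → ℝ) : Set (EuclideanSpace ℝ (Fin n)) :=
  {x | ∀ i, a i ≤ x i ∧ x i < a i + b i}

/-- The half-open cube with lower corner `a` and sidelength `t`. -/
abbrev icoCube {n : ℕ} (a : Fin n → ℝ) (t : ℝ) : Set (EuclideanSpace ℝ (Fin n)) :=
  icoBox a fun _ => t

theorem icoBox_eq_preimage {n : ℕ} (a b : Fin n → ℝ) :
    icoBox a b = WithLp.ofLp ⁻¹' (univ.pi fun i => Ico (a i) (a i + b i)) := by
  ext x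
  simp [icoBox, Set.mem_pi]

theorem measurableSet_icoBox {n : ℕ} (a b : Fin n → ℝ) : MeasurableSet (icoBox a b) := by
  rw [icoBox_eq_preimage]
  exact (PiLp.volume_preserving_ofLp (Fin n)).measurable
    (MeasurableSet.univ_pi fun i => measurableSet_Ico)

theorem volume_icoBox {n : ℕ} (a b : Fin n → ℝ) :
    volume (icoBox a b) = ∏ i, ENNReal.ofReal (b i) := by
  rw [icoBox_eq_preimage, (PiLp.volume_preserving_ofLp (Fin n)).measure_preimage
    (MeasurableSet.univ_pi fun i => measurableSet_Ico).nullMeasurableSet, Real.volume_pi_Ico]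
  simp

theorem volume_icoBox_ne_top {n : ℕ} (a b : Fin n → ℝ) : volume (icoBox a b) ≠ ⊤ := by
  rw [volume_icoBox]
  exact ENNReal.prod_ne_top fun i _ => ENNReal.ofReal_ne_top

theorem volume_real_icoBox {n : ℕ} (a : Fin n → ℝ) {b : Fin n → ℝ} (hb : ∀ i, 0 ≤ b i) :
    volume.real (icoBox a b) = ∏ i, b i := by
  rw [Measure.real, volume_icoBox, ENNReal.toReal_prod]
  exact Finset.prod_congr rfl fun i _ => ENNReal.toReal_ofReal (hb i)

theorem volume_real_icoCube {n : ℕ} (a : Fin n → ℝ) {t : ℝ} (ht : 0 ≤ t) :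
    volume.real (icoCube a t) = t ^ n := by
  rw [volume_real_icoBox a fun _ => ht]
  simp

theorem icoBox_ae_eq_closedBox {n : ℕ} (a b : Fin n → ℝ) :
    icoBox a b =ᵐ[volume] {x : EuclideanSpace ℝ (Fin n) | ∀ i, a i ≤ x i ∧ x i ≤ a i + b i} := by
  have h := (PiLp.volume_preserving_ofLp (Fin n)).quasiMeasurePreserving.preimage_ae_eq
    (Measure.univ_pi_Ico_ae_eq_Icc (μ := fun _ : Fin n => (volume : Measure ℝ))
      (f := a) (g := fun i => a i + b i))
  have h' : WithLp.ofLp ⁻¹' (Icc a fun i => a i + b i) =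
      {x : EuclideanSpace ℝ (Fin n) | ∀ i, a i ≤ x i ∧ x i ≤ a i + b i} := by
    ext x
    simp [Pi.le_def, forall_and]
  rwa [icoBox_eq_preimage, ← h']

theorem icoCube_ae_eq_cube {n : ℕ} (a : EuclideanSpace ℝ (Fin n)) (t : ℝ) :
    icoCube (fun i => a i) t =ᵐ[volume] cube a t :=
  icoBox_ae_eq_closedBox _ _

/-- The index of the cell containing `x` in the grid of half-open cubes of sidelength `t` that has
the point `o` as a vertex. -/
def gridIndex {n : ℕ} (o : Fin n → ℝ) (t : ℝ) (x : EuclideanSpace ℝ (Fin n)) : Fin n → ℤ :=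
  fun i => ⌊(x i - o i) / t⌋

theorem measurable_gridIndex {n : ℕ} (o : Fin n → ℝ) (t : ℝ) : Measurable (gridIndex o t) := by
  refine measurable_pi_lambda _ fun i => ?_
  unfold gridIndex
  fun_prop

theorem gridIndex_preimage_singleton {n : ℕ} (o : Fin n → ℝ) {t : ℝ} (ht : 0 < t)
    (z : Fin n → ℤ) :
    gridIndex o t ⁻¹' {z} = icoCube (fun i => o i + t * z i) t := by
  ext x
  simp only [mem_preimage, mem_singleton_iff, funext_iff, gridIndex, Int.floor_eq_iff, icoBox,
    mem_ofPred_eq, le_div_iff₀ ht, div_lt_iff₀ ht]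
  refine forall_congr' fun i => ?_
  constructor <;> rintro ⟨h1, h2⟩ <;> constructor <;> linarith

theorem volume_real_gridIndex_preimage_singleton {n : ℕ} (o : Fin n → ℝ) {t : ℝ} (ht : 0 < t)
    (z : Fin n → ℤ) : volume.real (gridIndex o t ⁻¹' {z}) = t ^ n := by
  rw [gridIndex_preimage_singleton o ht, volume_real_icoCube _ ht.le]

theorem hasSum_measureReal_fiber {α β : Type*} [MeasurableSpace α] [MeasurableSpace β]
    [Countable β] [MeasurableSingletonClass β] {μ : Measure α} {f : α → β} (hf : Measurable f)
    (Z : Set β) (h : μ (f ⁻¹' Z) ≠ ⊤) :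
    HasSum (fun z : Z => μ.real (f ⁻¹' {(z : β)})) (μ.real (f ⁻¹' Z)) := by
  have h1 : μ (f ⁻¹' Z) = ∑' z : Z, μ (f ⁻¹' {(z : β)}) := by
    conv_lhs => rw [← biUnion_of_singleton Z, preimage_iUnion₂]
    refine measure_biUnion Z.to_countable (fun x _ y _ hxy => ?_)
      fun z _ => hf (measurableSet_singleton z)
    exact Disjoint.preimage f (by simpa using hxy)
  have h2 := ENNReal.hasSum_toReal (f := fun z : Z => μ (f ⁻¹' {(z : β)})) (h1 ▸ h)
  rw [Measure.real, h1, ENNReal.tsum_toReal_eq]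
  · exact h2
  · intro z
    refine ne_top_of_le_ne_top h (measure_mono (preimage_mono ?_))
    simp

/-- A density estimate on every cell passes to a union of cells. -/
theorem abs_measureReal_sub_mul_le_of_cells {n : ℕ} {μ : Measure (EuclideanSpace ℝ (Fin n))}
    (hμ : μ ≤ volume) (o : Fin n → ℝ) {t : ℝ} (ht : 0 < t) {Z : Set (Fin n → ℤ)}
    (hZ : volume (gridIndex o t ⁻¹' Z) ≠ ⊤) {c ε : ℝ}
    (h : ∀ z ∈ Z, |μ.real (gridIndex o t ⁻¹' {z}) - c * t ^ n| ≤ ε * t ^ n) :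
    |μ.real (gridIndex o t ⁻¹' Z) - c * volume.real (gridIndex o t ⁻¹' Z)| ≤
      ε * volume.real (gridIndex o t ⁻¹' Z) := by
  have hm := measurable_gridIndex o t
  have h1 := hasSum_measureReal_fiber hm Z (ne_top_of_le_ne_top hZ (hμ _))
  have h2 := hasSum_measureReal_fiber hm Z hZ
  refine (h1.sub (h2.mul_left c)).norm_le_of_bounded (h2.mul_left ε) fun z => ?_
  rw [volume_real_gridIndex_preimage_singleton o ht]
  exact h z z.2

/-- An estimate of the difference of a measure on corresponding cells of two translated grids
passes to corresponding unions of cells. -/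
theorem abs_measureReal_sub_le_of_cells {n : ℕ} {μ : Measure (EuclideanSpace ℝ (Fin n))}
    (hμ : μ ≤ volume) (o o' : Fin n → ℝ) {t : ℝ} (ht : 0 < t) {Z : Set (Fin n → ℤ)}
    (hZ : volume (gridIndex o t ⁻¹' Z) ≠ ⊤) (hZ' : volume (gridIndex o' t ⁻¹' Z) ≠ ⊤) {ε : ℝ}
    (h : ∀ z ∈ Z, |μ.real (gridIndex o t ⁻¹' {z}) - μ.real (gridIndex o' t ⁻¹' {z})| ≤
      ε * t ^ n) :
    |μ.real (gridIndex o t ⁻¹' Z) - μ.real (gridIndex o' t ⁻¹' Z)| ≤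
      ε * volume.real (gridIndex o t ⁻¹' Z) := by
  have h1 := hasSum_measureReal_fiber (measurable_gridIndex o t) Z
    (ne_top_of_le_ne_top hZ (hμ _))
  have h1' := hasSum_measureReal_fiber (measurable_gridIndex o' t) Z
    (ne_top_of_le_ne_top hZ' (hμ _))
  have h2 := hasSum_measureReal_fiber (measurable_gridIndex o t) Z hZ
  refine (h1.sub h1').norm_le_of_bounded (h2.mul_left ε) fun z => ?_
  rw [volume_real_gridIndex_preimage_singleton o ht]
  exact h z z.2

/-! ### The oscillation of a measure on neighbouring cubes -/

/-- On cubes of sidelength `t`, the masses that `μ` gives to a cube and to its translate by one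
sidelength in a coordinate direction differ by at most `w * t ^ n`. -/
def AdjacentBound {n : ℕ} (μ : Measure (EuclideanSpace ℝ (Fin n))) (t w : ℝ) : Prop :=
  ∀ (a : Fin n → ℝ) (i : Fin n),
    |μ.real (icoCube (a + Pi.single i t) t) - μ.real (icoCube a t)| ≤ w * t ^ n

theorem AdjacentBound.abs_sub_single_natCast {n : ℕ} {μ : Measure (EuclideanSpace ℝ (Fin n))}
    {t w : ℝ} (h : AdjacentBound μ t w) (a : Fin n → ℝ) (i : Fin n) (m : ℕ) :
    |μ.real (icoCube (a + Pi.single i (t * m)) t) - μ.real (icoCube a t)| ≤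
      m * (w * t ^ n) := by
  induction m with
  | zero => simp
  | succ m ih =>
    have h1 := h (a + Pi.single i (t * m)) i
    have h2 : a + Pi.single i (t * m) + Pi.single i t = a + Pi.single i (t * ((m + 1 : ℕ) : ℝ)) := by
      rw [add_assoc, ← Pi.single_add]
      push_cast
      ring_nf
    rw [h2] at h1
    refine (abs_sub_le _ _ _).trans ((add_le_add h1 ih).trans (le_of_eq ?_))
    push_cast
    ring

theorem AdjacentBound.abs_sub_single_intCast {n : ℕ} {μ : Measure (EuclideanSpace ℝ (Fin n))}
    {t w : ℝ} (h : AdjacentBound μ t w) (a : Fin n → ℝ) (i : Fin n) (m : ℤ) :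
    |μ.real (icoCube (a + Pi.single i (t * m)) t) - μ.real (icoCube a t)| ≤
      |(m : ℝ)| * (w * t ^ n) := by
  obtain ⟨k, rfl | rfl⟩ := m.eq_nat_or_neg
  · simpa using h.abs_sub_single_natCast a i k
  · have h1 := h.abs_sub_single_natCast (a + Pi.single i (t * ((-(k : ℤ) : ℤ) : ℝ))) i k
    have h2 : a + Pi.single i (t * ((-(k : ℤ) : ℤ) : ℝ)) + Pi.single i (t * (k : ℝ)) = a := by
      rw [add_assoc, ← Pi.single_add]
      simp
    rw [h2, abs_sub_comm] at h1
    simpa using h1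

theorem AdjacentBound.abs_sub_le_of_grid {n : ℕ} {μ : Measure (EuclideanSpace ℝ (Fin n))}
    {t w : ℝ} (h : AdjacentBound μ t w) (hw : 0 ≤ w) (ht : 0 ≤ t) (o : Fin n → ℝ)
    {y z : Fin n → ℤ} {K : ℝ} (hK : ∀ i, |(z i : ℝ) - y i| ≤ K) :
    |μ.real (icoCube (fun i => o i + t * z i) t) - μ.real (icoCube (fun i => o i + t * y i) t)| ≤
      n * K * w * t ^ n := by
  set a : Fin n → ℝ := fun i => o i + t * y i with ha
  have key : ∀ s : Finset (Fin n),
      |μ.real (icoCube (a + ∑ i ∈ s, Pi.single i (t * ((z i - y i : ℤ) : ℝ))) t) -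
        μ.real (icoCube a t)| ≤ s.card * (K * (w * t ^ n)) := by
    intro s
    induction s using Finset.induction_on with
    | empty => simp
    | insert i s hi ih =>
      rw [Finset.sum_insert hi, Finset.card_insert_of_notMem hi, add_comm (Pi.single i _),
        ← add_assoc]
      have hi' : |((z i - y i : ℤ) : ℝ)| * (w * t ^ n) ≤ K * (w * t ^ n) := by
        refine mul_le_mul_of_nonneg_right ?_ (by positivity)
        push_cast
        exact hK i
      refine (abs_sub_le _ _ _).trans ((add_le_add
        ((h.abs_sub_single_intCast _ i _).trans hi') ih).trans (le_of_eq ?_))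
      push_cast
      ring
  have h1 := key Finset.univ
  rw [Finset.univ_sum_single] at h1
  have h2 : a + (fun i => t * ((z i - y i : ℤ) : ℝ)) = fun i => o i + t * z i := by
    funext i
    simp only [ha, Pi.add_apply]
    push_cast
    ring
  rw [h2] at h1
  refine h1.trans (le_of_eq ?_)
  simp only [Finset.card_univ, Fintype.card_fin]
  ring

/-! ### Mean values over regions with thin boundary -/

theorem gridIndex_eq_half {n : ℕ} (o : Fin n → ℝ) (t : ℝ) (x : EuclideanSpace ℝ (Fin n)) :
    gridIndex o t x = fun i => gridIndex o (t / 2) x i / 2 := by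
  funext i
  have h := Int.floor_div_natCast ((x i - o i) / (t / 2)) 2
  have h' : (x i - o i) / (t / 2) / ((2 : ℕ) : ℝ) = (x i - o i) / t := by
    push_cast
    rw [div_div, div_mul_cancel₀ t two_ne_zero]
  rw [h'] at h
  exact_mod_cast h

/-- The mean density of `μ` in the cell containing `x` of the grid of sidelength `t`. -/
def cellDensity {n : ℕ} (μ : Measure (EuclideanSpace ℝ (Fin n))) (o : Fin n → ℝ) (t : ℝ)
    (x : EuclideanSpace ℝ (Fin n)) : ℝ :=
  μ.real (gridIndex o t ⁻¹' {gridIndex o t x}) / t ^ n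

section CellDensity

variable {n : ℕ} {μ : Measure (EuclideanSpace ℝ (Fin n))} {o : Fin n → ℝ} {t w : ℝ}

theorem cellDensity_nonneg (ht : 0 < t) (x : EuclideanSpace ℝ (Fin n)) :
    0 ≤ cellDensity μ o t x :=
  div_nonneg measureReal_nonneg (by positivity)

theorem cellDensity_le_one (hμ : μ ≤ volume) (ht : 0 < t) (x : EuclideanSpace ℝ (Fin n)) :
    cellDensity μ o t x ≤ 1 := by
  refine div_le_one_of_le₀ ?_ (by positivity)
  rw [← volume_real_gridIndex_preimage_singleton o ht (gridIndex o t x)]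
  refine ENNReal.toReal_mono ?_ (hμ _)
  rw [gridIndex_preimage_singleton o ht]
  exact volume_icoBox_ne_top _ _

theorem abs_cellDensity_sub_le (h : AdjacentBound μ t w) (hw : 0 ≤ w) (ht : 0 < t)
    {x y : EuclideanSpace ℝ (Fin n)} {K : ℝ} (hK : ∀ i, |x i - y i| ≤ K * t) :
    |cellDensity μ o t x - cellDensity μ o t y| ≤ n * (K + 1) * w := by
  have ht' : 0 < t ^ n := by positivity
  rw [cellDensity, cellDensity, ← sub_div, abs_div, abs_of_pos ht', div_le_iff₀ ht',
    gridIndex_preimage_singleton o ht, gridIndex_preimage_singleton o ht]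
  refine h.abs_sub_le_of_grid hw ht.le o fun i => ?_
  have h1 : |(x i - o i) / t - (y i - o i) / t| ≤ K := by
    rw [← sub_div, abs_div, abs_of_pos ht, div_le_iff₀ ht]
    simpa using hK i
  rw [abs_le] at h1 ⊢
  simp only [gridIndex]
  have h2 := Int.floor_le ((x i - o i) / t)
  have h3 := Int.lt_floor_add_one ((x i - o i) / t)
  have h4 := Int.floor_le ((y i - o i) / t)
  have h5 := Int.lt_floor_add_one ((y i - o i) / t)
  constructor <;> linarith

/-- Halving the sidelength of the grid changes the mean density in the cell of `x` by at most
`n * w`: the cell is tiled by smaller ones, any two of which are joined by at most `n` steps to an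
adjacent cube. -/
theorem abs_cellDensity_half_sub_le (hμ : μ ≤ volume) (h : AdjacentBound μ (t / 2) w)
    (hw : 0 ≤ w) (ht : 0 < t) (x : EuclideanSpace ℝ (Fin n)) :
    |cellDensity μ o (t / 2) x - cellDensity μ o t x| ≤ n * w := by
  have ht2 : 0 < t / 2 := by positivity
  have htn : 0 < t ^ n := by positivity
  have ht2n : 0 < (t / 2) ^ n := by positivity
  have hpre : gridIndex o t ⁻¹' {gridIndex o t x} = gridIndex o (t / 2) ⁻¹'
      {z | (fun i => z i / 2) = gridIndex o t x} := by
    ext y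
    simp [gridIndex_eq_half o t y]
  have hvol := volume_real_gridIndex_preimage_singleton o ht (gridIndex o t x)
  have hfin : volume (gridIndex o t ⁻¹' {gridIndex o t x}) ≠ ⊤ := by
    rw [gridIndex_preimage_singleton o ht]
    exact volume_icoBox_ne_top _ _
  have key := abs_measureReal_sub_mul_le_of_cells hμ o ht2 (hpre ▸ hfin)
    (c := cellDensity μ o (t / 2) x) (ε := n * w) fun z hz => by
      rw [cellDensity, div_mul_cancel₀ _ ht2n.ne', gridIndex_preimage_singleton o ht2,
        gridIndex_preimage_singleton o ht2]
      refine (h.abs_sub_le_of_grid hw ht2.le o (K := 1) fun i => ?_).trans (by rw [mul_one])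
      have hz' : z i / 2 = gridIndex o (t / 2) x i / 2 := by
        have := congrFun hz i
        rwa [gridIndex_eq_half o t x] at this
      have : |z i - gridIndex o (t / 2) x i| ≤ 1 := by
        rw [abs_le]
        omega
      exact_mod_cast this
  rw [← hpre, hvol] at key
  rw [abs_sub_comm]
  nth_rewrite 1 [cellDensity]
  rw [div_sub' htn.ne', abs_div, abs_of_pos htn, div_le_iff₀ htn]
  rwa [mul_comm (t ^ n)]

theorem abs_cellDensity_sub_initial_le (hμ : μ ≤ volume)
    (h : ∀ s, 0 < s → s ≤ t → AdjacentBound μ s w) (hw : 0 ≤ w) (ht : 0 < t)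
    {x x₀ : EuclideanSpace ℝ (Fin n)} {K : ℝ} (hK : ∀ i, |x i - x₀ i| ≤ K * t) (k : ℕ) :
    |cellDensity μ o (t * (1 / 2) ^ k) x - cellDensity μ o t x₀| ≤ (n * (K + 1) + n * k) * w := by
  induction k with
  | zero => simpa using abs_cellDensity_sub_le (h t ht le_rfl) hw ht hK
  | succ k ih =>
    have h1 : t * (1 / 2) ^ (k + 1) = t * (1 / 2) ^ k / 2 := by ring
    have h2 : t * (1 / 2) ^ (k + 1) ≤ t :=
      mul_le_of_le_one_right ht.le (pow_le_one₀ (by norm_num) (by norm_num))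
    have h3 := abs_cellDensity_half_sub_le (o := o) (t := t * (1 / 2) ^ k) hμ
      (h1 ▸ h _ (by positivity) h2) hw (by positivity) x
    rw [h1]
    refine (abs_sub_le _ _ _).trans ((add_le_add h3 ih).trans (le_of_eq ?_))
    push_cast
    ring

end CellDensity

/-- The bound for the distance from the reference density on the cells of level `0`, plus the sum over `k`
of the bound on the cells of level `k + 1` times the relative volume of the layer left over at level
`k`. This is the constant in `abs_measureReal_sub_mul_le_of_thin_boundary`. -/
def regionConst (n : ℕ) (K B : ℝ) : ℝ :=
  n * (K + 1) + B * ∑' k : ℕ, (n * (K + 1) + n * (k + 1)) * (1 / 2 : ℝ) ^ k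

theorem summable_regionConst (n : ℕ) (K : ℝ) :
    Summable fun k : ℕ => (n * (K + 1) + n * (k + 1)) * (1 / 2 : ℝ) ^ k := by
  have h0 := summable_geometric_of_lt_one (r := (1 / 2 : ℝ)) (by norm_num) (by norm_num)
  have h1 := summable_pow_mul_geometric_of_norm_lt_one (r := (1 / 2 : ℝ)) 1 (by norm_num)
  refine ((h0.mul_left (n * (K + 1) + n)).add (h1.mul_left (n : ℝ))).congr fun k => ?_
  ring

theorem regionConst_nonneg (n : ℕ) {K B : ℝ} (hK : 0 ≤ K) (hB : 0 ≤ B) :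
    0 ≤ regionConst n K B := by
  have : 0 ≤ ∑' k : ℕ, (n * (K + 1) + n * (k + 1)) * (1 / 2 : ℝ) ^ k :=
    tsum_nonneg fun k => by positivity
  unfold regionConst
  positivity

/-- A region `R` whose boundary layer of width `s` has relative volume `O(s)` is exhausted by unions
`S k` of cells of sidelength `t / 2 ^ k`. On the cells added at stage `k` the density differs from
the reference density by `O(k * w)`, while their relative volume is `O(2 ^ (-k))`; hence
the mean density in `R` differs from the reference density by `O(w)`. -/
theorem abs_measureReal_sub_mul_le_of_thin_boundary {n : ℕ}
    {μ : Measure (EuclideanSpace ℝ (Fin n))} (hμ : μ ≤ volume) {t w : ℝ} (ht : 0 < t)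
    (hw : 0 ≤ w) (h : ∀ s, 0 < s → s ≤ t → AdjacentBound μ s w) (o : Fin n → ℝ)
    {R : Set (EuclideanSpace ℝ (Fin n))} (hR : volume R ≠ ⊤)
    {x₀ : EuclideanSpace ℝ (Fin n)} {K B : ℝ} (hK0 : 0 ≤ K) (hB : 0 ≤ B)
    (hK : ∀ x ∈ R, ∀ i, |x i - x₀ i| ≤ K * t)
    (hbd : ∀ s, 0 < s → s ≤ t → volume.real {x ∈ R | ∃ y ∉ R, ∀ i, |x i - y i| ≤ s} ≤
      B * (s / t) * volume.real R) :
    |μ.real R - cellDensity μ o t x₀ * volume.real R| ≤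
      regionConst n K B * w * volume.real R := by
  set c := cellDensity μ o t x₀ with hc
  set V := volume.real R with hV
  set T : ℕ → ℝ := fun k => t * (1 / 2) ^ k with hT
  have hTpos : ∀ k, 0 < T k := fun k => by positivity
  have hTle : ∀ k, T k ≤ t := fun k =>
    mul_le_of_le_one_right ht.le (pow_le_one₀ (by norm_num) (by norm_num))
  have hThalf : ∀ k, T (k + 1) = T k / 2 := fun k => by simp only [hT]; ring
  -- `Z k` indexes the cells of sidelength `T k` contained in `R`, and `S k` is their union.
  set Z : ℕ → Set (Fin n → ℤ) := fun k => {z | gridIndex o (T k) ⁻¹' {z} ⊆ R} with hZ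
  set S : ℕ → Set (EuclideanSpace ℝ (Fin n)) := fun k => gridIndex o (T k) ⁻¹' Z k with hS
  have hSm : ∀ k, MeasurableSet (S k) := fun k =>
    measurable_gridIndex o (T k) (Z k).to_countable.measurableSet
  have hSR : ∀ k, S k ⊆ R := fun k x hx => hx rfl
  have hfin : ∀ U, U ⊆ R → volume U ≠ ⊤ := fun U hU => ne_top_of_le_ne_top hR (measure_mono hU)
  have hfin' : ∀ U, U ⊆ R → μ U ≠ ⊤ := fun U hU => ne_top_of_le_ne_top (hfin U hU) (hμ _)
  have hSmono : ∀ k, S k ⊆ S (k + 1) := fun k x hx y hy => by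
    refine hx ?_
    rw [mem_preimage, mem_singleton_iff, gridIndex_eq_half o (T k) y,
      gridIndex_eq_half o (T k) x, ← hThalf, show gridIndex o (T (k + 1)) y = _ from hy]
  -- A point outside `S k` shares its cell with a point outside `R`.
  have hrest : ∀ k, volume.real (R \ S k) ≤ B * (1 / 2) ^ k * V := fun k => by
    have h1 : T k / t = (1 / 2) ^ k := by
      simp only [hT]
      field_simp
    have h2 := hbd (T k) (hTpos k) (hTle k)
    rw [h1] at h2
    refine (measureReal_mono ?_ (hfin _ fun x hx => hx.1)).trans h2
    rintro x ⟨hxR, hxS⟩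
    refine ⟨hxR, ?_⟩
    obtain ⟨y, hy, hyR⟩ := Set.not_subset.1 hxS
    refine ⟨y, hyR, fun i => ?_⟩
    have hi : ⌊(y i - o i) / T k⌋ = ⌊(x i - o i) / T k⌋ := congrFun hy i
    have := Int.abs_sub_lt_one_of_floor_eq_floor hi
    rw [← sub_div, abs_div, abs_of_pos (hTpos k), div_lt_one (hTpos k)] at this
    rw [abs_sub_comm]
    refine le_trans (le_of_eq ?_) this.le
    congr 1
    ring
  -- The density estimate on a union of cells of sidelength `T k` contained in `R`.
  have hcells : ∀ k (Y : Set (Fin n → ℤ)), Y ⊆ Z k →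
      |μ.real (gridIndex o (T k) ⁻¹' Y) - c * volume.real (gridIndex o (T k) ⁻¹' Y)| ≤
        (n * (K + 1) + n * k) * w * volume.real (gridIndex o (T k) ⁻¹' Y) := by
    intro k Y hY
    refine abs_measureReal_sub_mul_le_of_cells hμ o (hTpos k)
      (hfin _ ((preimage_mono hY).trans (hSR k))) fun z hz => ?_
    have hTn : 0 < T k ^ n := pow_pos (hTpos k) n
    obtain ⟨x, hx⟩ : (gridIndex o (T k) ⁻¹' {z}).Nonempty := by
      by_contra hne
      have h1 := volume_real_gridIndex_preimage_singleton o (hTpos k) z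
      rw [Set.not_nonempty_iff_eq_empty.1 hne, measureReal_empty] at h1
      exact hTn.ne h1
    have hxR : x ∈ R := hY hz hx
    have h1 := abs_cellDensity_sub_initial_le (o := o) hμ h hw ht (hK x hxR) k
    have hx' : gridIndex o (T k) x = z := hx
    rw [cellDensity, show gridIndex o (t * (1 / 2) ^ k) x = z from hx', ← hc,
      div_sub' hTn.ne', abs_div, abs_of_pos hTn, div_le_iff₀ hTn] at h1
    rwa [mul_comm c]
  have hsplit : ∀ (ν : Measure (EuclideanSpace ℝ (Fin n))) {U W : Set (EuclideanSpace ℝ (Fin n))},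
      MeasurableSet U → U ⊆ W → ν W ≠ ⊤ → ν.real W = ν.real U + ν.real (W \ U) := by
    intro ν U W hU hUW hW
    rw [← measureReal_inter_add_sdiff hU hW, inter_eq_self_of_subset_right hUW]
  have hind : ∀ k, |μ.real (S k) - c * volume.real (S k)| ≤
      w * V * (n * (K + 1) + B * ∑ j ∈ Finset.range k,
        (n * (K + 1) + n * (j + 1)) * (1 / 2 : ℝ) ^ j) := by
    intro k
    induction k with
    | zero =>
      have h1 := hcells 0 (Z 0) subset_rfl
      refine h1.trans ?_
      have h2 : volume.real (S 0) ≤ V := measureReal_mono (hSR 0) hR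
      have h3 : 0 ≤ (n * (K + 1) + n * (0 : ℕ)) * w := by positivity
      refine (mul_le_mul_of_nonneg_left h2 h3).trans (le_of_eq ?_)
      simp
      ring
    | succ k ih =>
      -- The layer added at this stage is a union of cells of the finer grid, by `gridIndex_eq_half`.
      set Y : Set (Fin n → ℤ) := Z (k + 1) \ {z | (fun i => z i / 2) ∈ Z k} with hY
      have hdiff : S (k + 1) \ S k = gridIndex o (T (k + 1)) ⁻¹' Y := by
        ext x
        simp only [hS, hY, Set.mem_sdiff, mem_preimage, mem_ofPred_eq]
        rw [gridIndex_eq_half o (T k) x, ← hThalf]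
      have h1 := hcells (k + 1) Y sdiff_subset
      rw [← hdiff] at h1
      have h2 : volume.real (S (k + 1) \ S k) ≤ B * (1 / 2) ^ k * V :=
        (measureReal_mono (sdiff_subset_sdiff_left (hSR (k + 1)))
          (hfin _ sdiff_subset)).trans (hrest k)
      have h3 : 0 ≤ (n * (K + 1) + n * ((k + 1 : ℕ) : ℝ)) * w := by positivity
      have h4 := h1.trans (mul_le_mul_of_nonneg_left h2 h3)
      rw [hsplit μ (hSm k) (hSmono k) (hfin' _ (hSR _)),
        hsplit volume (hSm k) (hSmono k) (hfin _ (hSR _))]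
      calc _ = |(μ.real (S k) - c * volume.real (S k)) +
            (μ.real (S (k + 1) \ S k) - c * volume.real (S (k + 1) \ S k))| := by
            congr 1
            ring
        _ ≤ _ := (abs_add_le _ _).trans (add_le_add ih h4)
        _ = _ := by
            rw [Finset.sum_range_succ]
            push_cast
            ring
  have hc0 : 0 ≤ c := cellDensity_nonneg ht x₀
  have hc1 : c ≤ 1 := cellDensity_le_one hμ ht x₀
  have hfinal : ∀ k : ℕ, |μ.real R - c * V| ≤
      regionConst n K B * w * V + B * (1 / 2) ^ k * V := by
    intro k
    have h1 : |μ.real (R \ S k) - c * volume.real (R \ S k)| ≤ B * (1 / 2) ^ k * V := by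
      refine le_trans ?_ (hrest k)
      have h2 : μ.real (R \ S k) ≤ volume.real (R \ S k) :=
        ENNReal.toReal_mono (hfin _ sdiff_subset) (hμ _)
      have h3 : 0 ≤ μ.real (R \ S k) := measureReal_nonneg
      rw [abs_le]
      constructor <;> nlinarith
    have h2 : B * ∑ j ∈ Finset.range k, (n * (K + 1) + n * (j + 1)) * (1 / 2 : ℝ) ^ j ≤
        B * ∑' j : ℕ, (n * (K + 1) + n * (j + 1)) * (1 / 2 : ℝ) ^ j :=
      mul_le_mul_of_nonneg_left
        ((summable_regionConst n K).sum_le_tsum _ fun j _ => by positivity) hB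
    have h3 : w * V * (n * (K + 1) + B * ∑ j ∈ Finset.range k,
        (n * (K + 1) + n * (j + 1)) * (1 / 2 : ℝ) ^ j) ≤ regionConst n K B * w * V := by
      rw [regionConst, mul_assoc _ w V, mul_comm _ (w * V)]
      exact mul_le_mul_of_nonneg_left (by linarith) (mul_nonneg hw measureReal_nonneg)
    have h4 := hsplit μ (hSm k) (hSR k) (hfin' _ subset_rfl)
    have h5 := hsplit volume (hSm k) (hSR k) hR
    calc _ = |(μ.real (S k) - c * volume.real (S k)) +
          (μ.real (R \ S k) - c * volume.real (R \ S k))| := by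
          rw [h4, hV, h5]
          congr 1
          ring
      _ ≤ _ := (abs_add_le _ _).trans (add_le_add ((hind k).trans h3) h1)
  have hlim : Tendsto (fun k : ℕ => regionConst n K B * w * V + B * (1 / 2 : ℝ) ^ k * V) atTop
      (𝓝 (regionConst n K B * w * V + B * 0 * V)) :=
    (((tendsto_pow_atTop_nhds_zero_of_lt_one (by norm_num) (by norm_num)).const_mul B).mul_const
      V).const_add _
  have := ge_of_tendsto' hlim hfinal
  simpa using this

/-! ### Consecutive cubes and densities -/

theorem consecutive_add_single {n : ℕ} (a : Fin n → ℝ) (i : Fin n) {l : ℝ} (hl : 0 < l) :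
    Consecutive (WithLp.toLp 2 a) (WithLp.toLp 2 (a + Pi.single i l)) l := by
  have hi : (a + Pi.single i l : Fin n → ℝ) i = a i + l := by simp
  have hj : ∀ j, j ≠ i → (a + Pi.single i l : Fin n → ℝ) j = a j := fun j hj => by simp [hj]
  refine ⟨⟨i, Or.inr ?_⟩, ⟨i, Or.inl ?_⟩⟩
  · ext x
    simp only [cube, mem_inter_iff, mem_ofPred_eq]
    constructor
    · rintro ⟨h1, h2⟩
      have h3 := (h2 i).1
      rw [hi] at h3
      exact ⟨h1, le_antisymm (h1 i).2 h3⟩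
    · rintro ⟨h1, h2⟩
      refine ⟨h1, fun j => ?_⟩
      by_cases hji : j = i
      · subst hji
        rw [hi]
        constructor <;> linarith
      · rw [hj j hji]
        exact h1 j
  · ext x
    simp only [cube, mem_inter_iff, mem_ofPred_eq]
    constructor
    · rintro ⟨h1, h2⟩
      have h3 := (h1 i).2
      rw [← hi] at h3
      exact ⟨h2, le_antisymm h3 (h2 i).1⟩
    · rintro ⟨h1, h2⟩
      refine ⟨fun j => ?_, h1⟩
      by_cases hji : j = i
      · subst hji
        rw [hi] at h2
        constructor <;> linarith
      · have := h1 j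
        rwa [hj j hji] at this

theorem Consecutive.nonempty_inter {n : ℕ} {a a' : EuclideanSpace ℝ (Fin n)} {l : ℝ}
    (hl : 0 < l) (h : Consecutive a a' l) : (cube a l ∩ cube a' l).Nonempty := by
  obtain ⟨⟨i, h | h⟩, -⟩ := h
  · rw [h]
    exact ⟨a, fun j => ⟨le_rfl, by linarith⟩, rfl⟩
  · rw [h]
    exact ⟨WithLp.toLp 2 fun j => a j + l, fun j => ⟨by simp [hl.le], le_rfl⟩, rfl⟩

/-- Two cubes whose intersection is a face of the first one differ by one sidelength in a
coordinate direction. -/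
theorem Consecutive.exists_eq_add_single {n : ℕ} {a a' : EuclideanSpace ℝ (Fin n)} {l : ℝ}
    (hl : 0 < l) (h : Consecutive a a' l) :
    ∃ i, (fun j => a' j) = (fun j => a j) + Pi.single i l ∨
      (fun j => a j) = (fun j => a' j) + Pi.single i l := by
  obtain ⟨p, hp, hp'⟩ := h.nonempty_inter hl
  obtain ⟨⟨i, h⟩, -⟩ := h
  refine ⟨i, ?_⟩
  -- The lower and the upper corner of the common face give the coordinates other than `i`.
  have hne : ∀ j, j ≠ i → a' j = a j := by
    have key : ∃ s, (∀ x ∈ cube a l, x i = s → x ∈ cube a' l) ∧ a i ≤ s ∧ s ≤ a i + l := by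
      rcases h with h | h
      · exact ⟨a i, fun x hx hxi => (h.ge ⟨hx, hxi⟩).2, le_rfl, by linarith⟩
      · exact ⟨a i + l, fun x hx hxi => (h.ge ⟨hx, hxi⟩).2, by linarith, le_rfl⟩
    obtain ⟨s, hs, hs1, hs2⟩ := key
    intro j hj
    have h1 := hs (WithLp.toLp 2 (Function.update (fun j => a j) i s)) (fun k => by
      by_cases hk : k = i
      · subst hk
        simpa using ⟨hs1, hs2⟩
      · simpa [hk] using hl.le) (by simp) j
    have h2 := hs (WithLp.toLp 2 (Function.update (fun j => a j + l) i s)) (fun k => by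
      by_cases hk : k = i
      · subst hk
        simpa using ⟨hs1, hs2⟩
      · simpa [hk] using hl.le) (by simp) j
    simp only [Function.update_of_ne hj] at h1 h2
    linarith [h1.1, h2.2]
  -- The point of the first cube with `i`-th coordinate `s` and the other coordinates of `a`.
  have hmem : ∀ s, a i ≤ s → s ≤ a i + l → a' i ≤ s → s ≤ a' i + l →
      ∃ x ∈ cube a l ∩ cube a' l, x i = s := by
    intro s h1 h2 h3 h4
    refine ⟨WithLp.toLp 2 (Function.update (fun j => a j) i s), ⟨fun k => ?_, fun k => ?_⟩,
      by simp⟩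
    · by_cases hk : k = i
      · subst hk
        simpa using ⟨h1, h2⟩
      · simpa [hk] using hl.le
    · by_cases hk : k = i
      · subst hk
        simpa using ⟨h3, h4⟩
      · simpa [hk, hne k hk] using hl.le
  have hpi := hp i
  have hpi' := hp' i
  have hcase : a' i = a i + l ∨ a i = a' i + l := by
    rcases h with h | h
    · right
      rcases le_or_gt (a' i) (a i) with h1 | h1
      · obtain ⟨x, hx, hxi⟩ := hmem (a' i + l) (by linarith) (by linarith) (by linarith) le_rfl
        rw [h] at hx
        rw [← hxi, hx.2]
      · obtain ⟨x, hx, hxi⟩ := hmem (a' i) h1.le (by linarith) le_rfl (by linarith)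
        rw [h] at hx
        linarith [hx.2]
    · left
      rcases le_or_gt (a i) (a' i) with h1 | h1
      · obtain ⟨x, hx, hxi⟩ := hmem (a' i) h1 (by linarith) le_rfl (by linarith)
        rw [h] at hx
        rw [← hxi, hx.2]
      · obtain ⟨x, hx, hxi⟩ := hmem (a i) le_rfl (by linarith) h1.le (by linarith)
        rw [h] at hx
        linarith [hx.2]
  refine hcase.imp (fun hc => ?_) (fun hc => ?_)
  · funext j
    by_cases hj : j = i
    · subst hj
      simpa using hc
    · simpa [hj] using hne j hj
  · funext j
    by_cases hj : j = i
    · subst hj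
      simpa using hc
    · simpa [hj] using (hne j hj).symm

theorem measurableSet_cube {n : ℕ} (a : EuclideanSpace ℝ (Fin n)) (l : ℝ) :
    MeasurableSet (cube a l) := by
  have : cube a l = ⋂ i, {x : EuclideanSpace ℝ (Fin n) | a i ≤ x i} ∩ {x | x i ≤ a i + l} := by
    ext x
    simp [cube]
  rw [this]
  exact MeasurableSet.iInter fun i =>
    (measurableSet_le measurable_const (by fun_prop)).inter
      (measurableSet_le (by fun_prop) measurable_const)

theorem volume_real_cube {n : ℕ} (a : EuclideanSpace ℝ (Fin n)) {l : ℝ} (hl : 0 ≤ l) :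
    volume.real (cube a l) = l ^ n := by
  rw [← measureReal_congr (icoCube_ae_eq_cube a l), volume_real_icoCube _ hl]

theorem volume_cube_ne_top {n : ℕ} (a : EuclideanSpace ℝ (Fin n)) (l : ℝ) :
    volume (cube a l) ≠ ⊤ := by
  rw [← measure_congr (icoCube_ae_eq_cube a l)]
  exact volume_icoBox_ne_top _ _

theorem density_cube {n : ℕ} (A : Set (EuclideanSpace ℝ (Fin n)))
    (a : EuclideanSpace ℝ (Fin n)) {l : ℝ} (hl : 0 ≤ l) :
    density A (cube a l) = (volume.restrict A).real (icoCube (fun i => a i) l) / l ^ n := by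
  rw [density, volume_real_cube a hl, measureReal_congr
    (ae_restrict_of_ae (icoCube_ae_eq_cube a l)), measureReal_restrict_apply
    (measurableSet_cube a l), inter_comm]

theorem density_nonneg {n : ℕ} (A Q : Set (EuclideanSpace ℝ (Fin n))) : 0 ≤ density A Q :=
  div_nonneg measureReal_nonneg measureReal_nonneg

theorem density_cube_le_one {n : ℕ} (A : Set (EuclideanSpace ℝ (Fin n)))
    (a : EuclideanSpace ℝ (Fin n)) (l : ℝ) : density A (cube a l) ≤ 1 :=
  div_le_one_of_le₀ (measureReal_mono inter_subset_right (volume_cube_ne_top a l))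
    measureReal_nonneg

theorem adjacentBound_restrict {n : ℕ} {A : Set (EuclideanSpace ℝ (Fin n))} {t w : ℝ}
    (ht : 0 < t) (h : ∀ a a', Consecutive a a' t →
      |density A (cube a t) - density A (cube a' t)| ≤ w) :
    AdjacentBound (volume.restrict A) t w := by
  intro a i
  have h1 := h _ _ (consecutive_add_single a i ht)
  have htn : 0 < t ^ n := by positivity
  rw [density_cube A _ ht.le, density_cube A _ ht.le, ← sub_div, abs_div, abs_of_pos htn,
    div_le_iff₀ htn, abs_sub_comm] at h1
  exact h1

theorem IsOmegaSmooth.adjacentBound {n : ℕ} {ω : ℝ → ℝ} {A : Set (EuclideanSpace ℝ (Fin n))}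
    (hω : IsModulus ω) (hA : IsOmegaSmooth ω A) {l : ℝ} (hl1 : l ≤ 1) {s : ℝ}
    (hs : 0 < s) (hsl : s ≤ l) : AdjacentBound (volume.restrict A) s (ω l) := by
  refine adjacentBound_restrict hs fun a a' haa' => ?_
  exact (hA.2 s a a' hs (hsl.trans hl1) haa').trans
    (hω.monotoneOn ⟨hs.le, hsl.trans hl1⟩ ⟨hs.le.trans hsl, hl1⟩ hsl)

/-! ### Images under invertible linear maps -/

section Linear

variable {n : ℕ} {φ : EuclideanSpace ℝ (Fin n) →ₗ[ℝ] EuclideanSpace ℝ (Fin n)}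

theorem volume_real_preimage_linearMap (hφ : LinearMap.det φ ≠ 0)
    (S : Set (EuclideanSpace ℝ (Fin n))) :
    volume.real (φ ⁻¹' S) = |(LinearMap.det φ)⁻¹| * volume.real S := by
  rw [Measure.real, Measure.addHaar_preimage_linearMap _ hφ, ENNReal.toReal_mul,
    ENNReal.toReal_ofReal (abs_nonneg _), Measure.real]

theorem injective_of_det_ne_zero (hφ : LinearMap.det φ ≠ 0) : Function.Injective φ :=
  ((LinearMap.isUnit_iff_isUnit_det φ).2 hφ.isUnit |> (Module.End.isUnit_iff φ).1).1

theorem nullMeasurableSet_image_linearMap (hφ : LinearMap.det φ ≠ 0)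
    {A : Set (EuclideanSpace ℝ (Fin n))} (hA : NullMeasurableSet A volume) :
    NullMeasurableSet (φ '' A) volume := by
  let e := LinearEquiv.ofIsUnitDet (f := φ) (v := Module.finBasis ℝ _) (v' := Module.finBasis ℝ _)
    (by rw [LinearMap.det_toMatrix]; exact hφ.isUnit)
  have he : ∀ x, e x = φ x := fun x => rfl
  have h1 : φ '' A = (e.symm : EuclideanSpace ℝ (Fin n) →ₗ[ℝ] _) ⁻¹' A := by
    ext y
    simp only [mem_image, mem_preimage, LinearEquiv.coe_coe]
    constructor
    · rintro ⟨x, hx, rfl⟩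
      rwa [← he, e.symm_apply_apply]
    · intro hy
      exact ⟨_, hy, by rw [← he, e.apply_symm_apply]⟩
  rw [h1]
  refine hA.preimage (Measure.LinearMap.quasiMeasurePreserving volume _ ?_)
  exact (LinearEquiv.isUnit_det' e.symm).ne_zero

theorem density_image_linearMap (hφ : LinearMap.det φ ≠ 0)
    (A : Set (EuclideanSpace ℝ (Fin n))) {Q : Set (EuclideanSpace ℝ (Fin n))}
    (hQ : MeasurableSet Q) :
    density (φ '' A) Q =
      (volume.restrict A).real (φ ⁻¹' Q) / volume.real (φ ⁻¹' Q) := by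
  have hm : MeasurableSet (φ ⁻¹' Q) := φ.continuous_of_finiteDimensional.measurable hQ
  have h1 : φ ⁻¹' (φ '' A ∩ Q) = φ ⁻¹' Q ∩ A := by
    rw [preimage_inter, preimage_image_eq A (injective_of_det_ne_zero hφ), inter_comm]
  rw [measureReal_restrict_apply hm, ← h1, volume_real_preimage_linearMap hφ,
    volume_real_preimage_linearMap hφ, mul_div_mul_left, density]
  simpa using hφ

theorem norm_le_of_abs_apply_le {x : EuclideanSpace ℝ (Fin n)} {c : ℝ} (hc : 0 ≤ c)
    (h : ∀ i, |x i| ≤ c) : ‖x‖ ≤ n * c := by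
  rcases Nat.eq_zero_or_pos n with rfl | hn
  · simp [Subsingleton.elim x 0]
  have hn' : (1 : ℝ) ≤ n := by exact_mod_cast hn
  refine abs_le_of_sq_le_sq' ?_ (by positivity) |>.2
  rw [EuclideanSpace.real_norm_sq_eq]
  calc ∑ i, x i ^ 2 ≤ ∑ _i : Fin n, c ^ 2 :=
        Finset.sum_le_sum fun i _ => sq_le_sq' (abs_le.1 (h i)).1 (abs_le.1 (h i)).2
    _ = n * c ^ 2 := by simp
    _ ≤ (n * c) ^ 2 := by nlinarith [sq_nonneg c, mul_nonneg (sq_nonneg c) (sub_nonneg.2 hn')]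

theorem abs_apply_le_norm (x : EuclideanSpace ℝ (Fin n)) (i : Fin n) : |x i| ≤ ‖x‖ :=
  PiLp.norm_apply_le x i

theorem volume_real_slab (a : Fin n → ℝ) (i : Fin n) {l h : ℝ} (hl : 0 < l) (hh : 0 ≤ h) :
    volume.real (icoBox a (Function.update (fun _ => l) i h)) = h / l * l ^ n := by
  rw [volume_real_icoBox, Finset.prod_update_of_mem (Finset.mem_univ i)]
  · have hn : n ≠ 0 := fun h0 => by
      subst h0
      exact i.elim0
    obtain ⟨m, rfl⟩ := Nat.exists_eq_succ_of_ne_zero hn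
    simp [Finset.card_sdiff, pow_succ]
    field_simp
  · intro j
    by_cases hj : j = i
    · subst hj
      simpa using hh
    · simpa [hj] using hl.le

/-- The layer of points of a cube within `h` of its complement is covered by `2 * n` slabs. -/
theorem volume_real_cube_layer_le (a : EuclideanSpace ℝ (Fin n)) {l h : ℝ} (hl : 0 < l)
    (hh : 0 ≤ h) :
    volume.real {x ∈ cube a l | ∃ y ∉ cube a l, ∀ i, |x i - y i| ≤ h} ≤
      2 * n * (h / l) * l ^ n := by
  -- `lo i` and `hi i` are the slabs of thickness `h` along the two faces orthogonal to direction `i`;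
  -- they are allowed to stick out of the cube when `h > l`.
  let b : Fin n → Fin n → ℝ := fun i => Function.update (fun _ => l) i h
  let lo : Fin n → Set (EuclideanSpace ℝ (Fin n)) := fun i =>
    {x | ∀ j, a j ≤ x j ∧ x j ≤ a j + b i j}
  let a' : Fin n → Fin n → ℝ := fun i => Function.update (fun j => a j) i (a i + l - h)
  let hi : Fin n → Set (EuclideanSpace ℝ (Fin n)) := fun i =>
    {x | ∀ j, a' i j ≤ x j ∧ x j ≤ a' i j + b i j}
  have hlo : ∀ i, volume.real (lo i) = h / l * l ^ n := fun i => by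
    rw [← measureReal_congr (icoBox_ae_eq_closedBox _ _)]
    exact volume_real_slab _ i hl hh
  have hhi : ∀ i, volume.real (hi i) = h / l * l ^ n := fun i => by
    rw [← measureReal_congr (icoBox_ae_eq_closedBox _ _)]
    exact volume_real_slab _ i hl hh
  have hlot : ∀ i, volume (lo i) ≠ ⊤ := fun i => by
    rw [← measure_congr (icoBox_ae_eq_closedBox _ _)]
    exact volume_icoBox_ne_top _ _
  have hhit : ∀ i, volume (hi i) ≠ ⊤ := fun i => by
    rw [← measure_congr (icoBox_ae_eq_closedBox _ _)]
    exact volume_icoBox_ne_top _ _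
  have hsub : {x ∈ cube a l | ∃ y ∉ cube a l, ∀ i, |x i - y i| ≤ h} ⊆ ⋃ i, (lo i ∪ hi i) := by
    rintro x ⟨hx, y, hy, hxy⟩
    simp only [cube, mem_ofPred_eq, not_forall] at hy
    obtain ⟨i, hy⟩ := hy
    have hxyi := abs_le.1 (hxy i)
    refine mem_iUnion.2 ⟨i, ?_⟩
    rw [not_and_or, not_le, not_le] at hy
    refine hy.imp (fun hy j => ?_) (fun hy j => ?_)
    · by_cases hj : j = i
      · subst hj
        simp only [b, Function.update_self]
        exact ⟨(hx j).1, by linarith⟩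
      · simpa only [b, Function.update_of_ne hj] using hx j
    · by_cases hj : j = i
      · subst hj
        simp only [a', b, Function.update_self]
        exact ⟨by linarith, by linarith [(hx j).2]⟩
      · simpa only [a', b, Function.update_of_ne hj] using hx j
  refine (measureReal_mono hsub ?_).trans ((measureReal_iUnion_fintype_le _).trans ?_)
  · exact ((measure_iUnion_fintype_le _ _).trans_lt (ENNReal.sum_lt_top.2 fun i _ =>
      (measure_union_lt_top (hlot i).lt_top (hhit i).lt_top))).ne
  · calc ∑ i, volume.real (lo i ∪ hi i) ≤ ∑ _i : Fin n, 2 * (h / l * l ^ n) :=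
          Finset.sum_le_sum fun i _ => (measureReal_union_le _ _).trans (by
            rw [hlo, hhi, two_mul])
      _ = 2 * n * (h / l) * l ^ n := by
          simp
          ring

/-- The constant in `abs_density_image_sub_le`. -/
def linearConst (n : ℕ) (M M' : ℝ) : ℝ :=
  2 * regionConst n (M' * n) (2 * n * (M * n))

theorem linearConst_nonneg (n : ℕ) {M M' : ℝ} (hM : 0 ≤ M) (hM' : 0 ≤ M') :
    0 ≤ linearConst n M M' :=
  mul_nonneg zero_le_two (regionConst_nonneg n (by positivity) (by positivity))

/-- The preimages of two consecutive cubes have thin boundary and a common point `x₀`; the density of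
`A` in either of them is compared with the density in the grid cell containing `x₀`. The hypotheses
on `φ` enter only through the bounds `M` and `M'`, the determinant cancelling. -/
theorem abs_density_image_sub_le (hφ : LinearMap.det φ ≠ 0) {M M' : ℝ} (hM0 : 0 ≤ M)
    (hM0' : 0 ≤ M') (hM : ∀ x, ‖φ x‖ ≤ M * ‖x‖) (hM' : ∀ x, ‖x‖ ≤ M' * ‖φ x‖)
    {A : Set (EuclideanSpace ℝ (Fin n))} {l w : ℝ} (hl : 0 < l) (hw : 0 ≤ w)
    (h : ∀ s, 0 < s → s ≤ l → AdjacentBound (volume.restrict A) s w)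
    {a a' : EuclideanSpace ℝ (Fin n)} (haa' : Consecutive a a' l) :
    |density (φ '' A) (cube a l) - density (φ '' A) (cube a' l)| ≤ linearConst n M M' * w := by
  obtain ⟨p, hp, hp'⟩ := haa'.nonempty_inter hl
  obtain ⟨x₀, rfl⟩ : ∃ x, φ x = p :=
    (LinearMap.injective_iff_surjective.1 (injective_of_det_ne_zero hφ)) p
  have hdet : 0 < |(LinearMap.det φ)⁻¹| := abs_pos.2 (inv_ne_zero hφ)
  have key : ∀ b : EuclideanSpace ℝ (Fin n), φ x₀ ∈ cube b l →
      |density (φ '' A) (cube b l) - cellDensity (volume.restrict A) 0 l x₀| ≤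
        regionConst n (M' * n) (2 * n * (M * n)) * w := by
    intro b hb
    have hV : volume.real (φ ⁻¹' cube b l) = |(LinearMap.det φ)⁻¹| * l ^ n := by
      rw [volume_real_preimage_linearMap hφ, volume_real_cube b hl.le]
    have hVpos : 0 < volume.real (φ ⁻¹' cube b l) := by
      rw [hV]
      positivity
    have hfin : volume (φ ⁻¹' cube b l) ≠ ⊤ := by
      rw [Measure.addHaar_preimage_linearMap _ hφ]
      exact ENNReal.mul_ne_top ENNReal.ofReal_ne_top (volume_cube_ne_top b l)
    have h1 := abs_measureReal_sub_mul_le_of_thin_boundary (Measure.restrict_le_self (s := A)) hl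
      hw h 0 hfin (x₀ := x₀) (K := M' * n) (B := 2 * n * (M * n)) (by positivity)
      (by positivity) (fun x hx i => ?_) (fun s hs _ => ?_)
    · rw [density_image_linearMap hφ A (measurableSet_cube b l), div_sub' hVpos.ne', abs_div,
        abs_of_pos hVpos, div_le_iff₀ hVpos]
      rwa [mul_comm (volume.real _) (cellDensity _ _ _ _)]
    · have h2 : ‖φ (x - x₀)‖ ≤ n * l := by
        refine norm_le_of_abs_apply_le hl.le fun j => ?_
        have hxj : b j ≤ φ x j ∧ φ x j ≤ b j + l := hx j
        have hbj := hb j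
        rw [map_sub, PiLp.sub_apply, abs_le]
        constructor <;> linarith
      have h3 := abs_apply_le_norm (x - x₀) i
      rw [PiLp.sub_apply] at h3
      refine (h3.trans (hM' _)).trans ?_
      rw [mul_assoc]
      exact mul_le_mul_of_nonneg_left h2 hM0'
    · have hsub : {x ∈ φ ⁻¹' cube b l | ∃ y ∉ φ ⁻¹' cube b l, ∀ i, |x i - y i| ≤ s} ⊆
          φ ⁻¹' {x ∈ cube b l | ∃ y ∉ cube b l, ∀ i, |x i - y i| ≤ M * (n * s)} := by
        rintro x ⟨hx, y, hy, hxy⟩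
        refine ⟨hx, φ y, hy, fun i => ?_⟩
        have h2 := abs_apply_le_norm (φ (x - y)) i
        rw [map_sub, PiLp.sub_apply] at h2
        rw [← map_sub] at h2
        refine (h2.trans (hM _)).trans (mul_le_mul_of_nonneg_left ?_ hM0)
        exact norm_le_of_abs_apply_le hs.le fun j => hxy j
      have hfin' : volume (φ ⁻¹' {x ∈ cube b l | ∃ y ∉ cube b l,
          ∀ i, |x i - y i| ≤ M * (n * s)}) ≠ ⊤ :=
        ne_top_of_le_ne_top hfin (measure_mono fun x hx => hx.1)
      refine (measureReal_mono hsub hfin').trans ?_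
      rw [hV, volume_real_preimage_linearMap hφ]
      refine (mul_le_mul_of_nonneg_left (volume_real_cube_layer_le b hl (h := M * (n * s))
        (by positivity)) hdet.le).trans (le_of_eq ?_)
      ring
  have key' := key a' hp'
  rw [abs_sub_comm] at key'
  refine (abs_sub_le _ (cellDensity (volume.restrict A) 0 l x₀) _).trans
    ((add_le_add (key a hp) key').trans (le_of_eq ?_))
  rw [linearConst]
  ring

end Linear

theorem bddAbove_oscillation {n : ℕ} (A : Set (EuclideanSpace ℝ (Fin n))) (δ : ℝ) :
    BddAbove {r | ∃ (l : ℝ) (a a' : EuclideanSpace ℝ (Fin n)), 0 < l ∧ l ≤ δ ∧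
      Consecutive a a' l ∧ r = |density A (cube a l) - density A (cube a' l)|} := by
  refine ⟨1, ?_⟩
  rintro _ ⟨l, a, a', -, -, -, rfl⟩
  have h1 := density_nonneg A (cube a l)
  have h2 := density_nonneg A (cube a' l)
  have h3 := density_cube_le_one A a l
  have h4 := density_cube_le_one A a' l
  rw [abs_le]
  constructor <;> linarith

theorem oscillation_nonneg {n : ℕ} (A : Set (EuclideanSpace ℝ (Fin n))) (δ : ℝ) :
    0 ≤ oscillation A δ := by
  refine Real.sSup_nonneg ?_
  rintro _ ⟨l, a, a', -, -, -, rfl⟩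
  exact abs_nonneg _

theorem isSmooth_of_oscillation_le {n : ℕ} {A A' : Set (EuclideanSpace ℝ (Fin n))}
    (hA : IsSmooth A) (hA' : NullMeasurableSet A' volume) {C : ℝ}
    (h : ∀ δ, oscillation A' δ ≤ C * oscillation A δ) : IsSmooth A' := by
  refine ⟨hA', squeeze_zero (fun δ => oscillation_nonneg A' δ) h ?_⟩
  simpa using hA.2.const_mul C

/-- A singular `φ` has a null image, and null sets are smooth. -/
theorem IsSmooth.image_linearMap {n : ℕ} {A : Set (EuclideanSpace ℝ (Fin n))} (hA : IsSmooth A)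
    (φ : EuclideanSpace ℝ (Fin n) →ₗ[ℝ] EuclideanSpace ℝ (Fin n)) : IsSmooth (φ '' A) := by
  by_cases hφ : LinearMap.det φ = 0
  · have h0 : volume (φ '' A) = 0 := by
      rw [Measure.addHaar_image_linearMap, hφ]
      simp
    have hd : ∀ Q, density (φ '' A) Q = 0 := fun Q => by
      have : volume (φ '' A ∩ Q) = 0 := measure_mono_null inter_subset_left h0
      rw [density, Measure.real, this]
      simp
    refine isSmooth_of_oscillation_le hA (NullMeasurableSet.of_null h0) (C := 0) fun δ => ?_
    rw [zero_mul]
    refine Real.sSup_le ?_ le_rfl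
    rintro _ ⟨l, a, a', -, -, -, rfl⟩
    simp [hd]
  · obtain ⟨K, -, hK⟩ := φ.exists_antilipschitzWith
      (LinearMap.ker_eq_bot.2 (injective_of_det_ne_zero hφ))
    refine isSmooth_of_oscillation_le hA (nullMeasurableSet_image_linearMap hφ hA.1)
      (C := linearConst n ‖φ.toContinuousLinearMap‖ K) fun δ => ?_
    have hC := linearConst_nonneg n (norm_nonneg φ.toContinuousLinearMap) K.2
    refine Real.sSup_le ?_ (mul_nonneg hC (oscillation_nonneg A δ))
    rintro _ ⟨l, a, a', hl, hlδ, haa', rfl⟩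
    refine abs_density_image_sub_le hφ (norm_nonneg _) K.2
      (fun x => φ.toContinuousLinearMap.le_opNorm x)
      (fun x => by simpa using hK.le_mul_dist x 0) hl (oscillation_nonneg A δ)
      (fun s hs hsl => ?_) haa'
    exact adjacentBound_restrict hs fun b b' hbb' =>
      le_csSup (bddAbove_oscillation A δ) ⟨s, b, b', hs, hsl.trans hlδ, hbb', rfl⟩

/-- The summand `1` makes the constant positive in all dimensions. -/
theorem IsOmegaSmooth.image_rotation {n : ℕ} {ω : ℝ → ℝ} (hω : IsModulus ω)
    {A : Set (EuclideanSpace ℝ (Fin n))} (hA : IsOmegaSmooth ω A)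
    {φ : EuclideanSpace ℝ (Fin n) →ₗ[ℝ] EuclideanSpace ℝ (Fin n)} (hφ : IsRotation φ) :
    IsOmegaSmooth (fun t => (linearConst n 1 1 + 1) * ω t) (φ '' A) := by
  have hdet : LinearMap.det φ ≠ 0 := by simp [hφ.2]
  refine ⟨nullMeasurableSet_image_linearMap hdet hA.1, fun l a a' hl hl1 haa' => ?_⟩
  have hw : 0 ≤ ω l := hω.mapsTo ⟨hl.le, hl1⟩
  refine (abs_density_image_sub_le hdet zero_le_one zero_le_one (fun x => by simp [hφ.1 x])
    (fun x => by simp [hφ.1 x]) hl hw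
    (fun s hs hsl => hA.adjacentBound hω hl1 hs hsl) haa').trans ?_
  exact mul_le_mul_of_nonneg_right (by linarith) hw

/-! ### Functions with a Zygmund-type bound on second differences -/

/-- A Lipschitz function whose second differences with steps `l / 2 ^ k` are at most
`l / 2 ^ k * W` deviates from its chord over an interval of length `l` by at most `l * W / 2`:
passing to the chords of the two halves costs `l * W / 4` and halves the deviation. -/
theorem abs_sub_chord_le {F : ℝ → ℝ} {L W : ℝ} (hL0 : 0 ≤ L)
    (hL : ∀ x y, |F x - F y| ≤ L * |x - y|) {l : ℝ} (hl : 0 < l)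
    (hF : ∀ (k : ℕ) (x : ℝ), |F (x + l / 2 ^ k) - 2 * F x + F (x - l / 2 ^ k)| ≤ l / 2 ^ k * W)
    (x : ℝ) {θ : ℝ} (hθ0 : 0 ≤ θ) (hθ1 : θ ≤ 1) :
    |F (x + θ * l) - ((1 - θ) * F x + θ * F (x + l))| ≤ l * W / 2 := by
  have key : ∀ (K : ℕ) (l : ℝ), 0 < l →
      (∀ (k : ℕ) (x : ℝ), |F (x + l / 2 ^ k) - 2 * F x + F (x - l / 2 ^ k)| ≤ l / 2 ^ k * W) →
      ∀ x θ : ℝ, 0 ≤ θ → θ ≤ 1 →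
      |F (x + θ * l) - ((1 - θ) * F x + θ * F (x + l))| ≤
        l * W / 2 + 2 * L * l * (1 / 2) ^ K := by
    intro K
    induction K with
    | zero =>
      intro l hl hF x θ hθ0 hθ1
      have h1 := hL (x + θ * l) x
      have h2 := hL (x + l) x
      have h3 := (abs_nonneg _).trans (hF 0 x)
      rw [add_sub_cancel_left, abs_of_nonneg (mul_nonneg hθ0 hl.le)] at h1
      rw [add_sub_cancel_left, abs_of_pos hl] at h2
      have h4 : F (x + θ * l) - ((1 - θ) * F x + θ * F (x + l)) =
          (F (x + θ * l) - F x) - θ * (F (x + l) - F x) := by ring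
      rw [h4]
      have h5 : |θ * (F (x + l) - F x)| ≤ 1 * (L * l) := by
        rw [abs_mul, abs_of_nonneg hθ0]
        exact mul_le_mul hθ1 h2 (abs_nonneg _) zero_le_one
      have h6 : L * (θ * l) ≤ L * l :=
        mul_le_mul_of_nonneg_left (mul_le_of_le_one_left hl.le hθ1) hL0
      have h7 := abs_sub (F (x + θ * l) - F x) (θ * (F (x + l) - F x))
      simp only [pow_zero, div_one] at h3 ⊢
      linarith
    | succ K ih =>
      intro l hl hF x θ hθ0 hθ1
      have hF2 : ∀ (k : ℕ) (x : ℝ),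
          |F (x + l / 2 / 2 ^ k) - 2 * F x + F (x - l / 2 / 2 ^ k)| ≤ l / 2 / 2 ^ k * W := by
        intro k x
        have := hF (k + 1) x
        rwa [pow_succ', ← div_div] at this
      have hmid := hF 1 (x + l / 2)
      rw [pow_one, add_sub_cancel_right, add_assoc, add_halves] at hmid
      have hpow : 2 * L * l * (1 / 2) ^ (K + 1) = L * l * (1 / 2) ^ K := by ring
      have hscale : ∀ η : ℝ, 0 ≤ η → η ≤ 1 / 2 →
          |η * (F (x + l) - 2 * F (x + l / 2) + F x)| ≤ 1 / 2 * (l / 2 * W) := by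
        intro η h0 h1
        rw [abs_mul, abs_of_nonneg h0]
        exact mul_le_mul h1 hmid (abs_nonneg _) (by norm_num)
      rw [hpow]
      rcases le_total θ (1 / 2) with hθ | hθ
      · have h1 := ih (l / 2) (by positivity) hF2 x (2 * θ) (by linarith) (by linarith)
        rw [show x + 2 * θ * (l / 2) = x + θ * l by ring, abs_le] at h1
        have h2 := abs_le.1 (hscale θ hθ0 hθ)
        rw [abs_le]
        constructor <;> linarith
      · have h1 := ih (l / 2) (by positivity) hF2 (x + l / 2) (2 * θ - 1) (by linarith)
          (by linarith)
        rw [show x + l / 2 + (2 * θ - 1) * (l / 2) = x + θ * l by ring, add_assoc x, add_halves,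
          abs_le] at h1
        have h2 := abs_le.1 (hscale (1 - θ) (by linarith) (by linarith))
        rw [abs_le]
        constructor <;> linarith
  have hlim : Tendsto (fun K : ℕ => l * W / 2 + 2 * L * l * (1 / 2 : ℝ) ^ K) atTop
      (𝓝 (l * W / 2 + 2 * L * l * 0)) :=
    ((tendsto_pow_atTop_nhds_zero_of_lt_one (by norm_num) (by norm_num)).const_mul _).const_add _
  have := ge_of_tendsto' hlim fun K => key K l hl hF x θ hθ0 hθ1
  simpa using this

theorem abs_sub_natCast_mul_le {F : ℝ → ℝ} {h B : ℝ} (hF : ∀ x, |F (x + h) - F x| ≤ B) (N : ℕ)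
    (x : ℝ) : |F (x + N * h) - F x| ≤ N * B := by
  induction N with
  | zero => simp
  | succ N ih =>
    have h1 := hF (x + N * h)
    rw [show x + N * h + h = x + ((N + 1 : ℕ) : ℝ) * h by push_cast; ring] at h1
    refine (abs_sub_le _ _ _).trans ((add_le_add h1 ih).trans (le_of_eq ?_))
    push_cast
    ring

theorem abs_second_difference_natCast_mul_le {F : ℝ → ℝ} {h B : ℝ}
    (hF : ∀ x, |F (x + h) - 2 * F x + F (x - h)| ≤ B) (N : ℕ) (x : ℝ) :
    |F (x + N * h) - 2 * F x + F (x - N * h)| ≤ N ^ 2 * B := by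
  set G : ℝ → ℝ := fun y => F (y + h) - F y with hG
  -- The bound says that the first difference `G` changes by at most `B` over one step; the points
  -- `x - (N + 1) * h` and `x + N * h` are `2 * N + 1` steps apart.
  have hd : ∀ y, |G (y + h) - G y| ≤ B := by
    intro y
    have := hF (y + h)
    rw [add_sub_cancel_right] at this
    convert this using 2
    simp only [hG]
    ring
  induction N with
  | zero => simp [two_mul]
  | succ N ih =>
    have h1 := abs_sub_natCast_mul_le hd (2 * N + 1) (x - (N + 1 : ℕ) * h)
    simp only [hG] at h1
    rw [show x - (N + 1 : ℕ) * h + ((2 * N + 1 : ℕ) : ℝ) * h = x + N * h by push_cast; ring,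
      show x + N * h + h = x + (N + 1 : ℕ) * h by push_cast; ring,
      show x - (N + 1 : ℕ) * h + h = x - N * h by push_cast; ring] at h1
    push_cast at h1 ih ⊢
    rw [abs_le] at h1 ih ⊢
    constructor <;> linarith

/-- An arbitrary step `s` is split into equal steps of length at most `l`. -/
theorem exists_natCast_mul_eq {s l : ℝ} (hs : 0 < s) (hl : 0 < l) :
    ∃ (N : ℕ) (θ : ℝ), 0 ≤ θ ∧ θ ≤ 1 ∧ N * (θ * l) = s ∧ (N : ℝ) ≤ s / l + 1 := by
  have hsl : 0 < s / l := by positivity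
  have hN : 0 < (⌈s / l⌉₊ : ℝ) := by exact_mod_cast Nat.ceil_pos.2 hsl
  refine ⟨⌈s / l⌉₊, s / l / ⌈s / l⌉₊, by positivity, ?_, ?_, (Nat.ceil_lt_add_one hsl.le).le⟩
  · exact div_le_one_of_le₀ (Nat.le_ceil _) hN.le
  · field_simp

/-- The bound on second differences with steps `l / 2 ^ k` extends to an arbitrary step `s`. A step
`θ * l` with `θ ≤ 1` is handled by the chords to the right and to the left of the point. -/
theorem abs_second_difference_le {F : ℝ → ℝ} {L W : ℝ} (hL0 : 0 ≤ L)
    (hL : ∀ x y, |F x - F y| ≤ L * |x - y|) {l : ℝ} (hl : 0 < l)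
    (hF : ∀ (k : ℕ) (x : ℝ), |F (x + l / 2 ^ k) - 2 * F x + F (x - l / 2 ^ k)| ≤ l / 2 ^ k * W)
    {s : ℝ} (hs : 0 < s) (x : ℝ) :
    |F (x + s) - 2 * F x + F (x - s)| ≤ (2 * (s / l) * s + 3 * s + l) * W := by
  have hW : 0 ≤ W := by
    have := (abs_nonneg _).trans (hF 0 0)
    rw [pow_zero, div_one] at this
    exact nonneg_of_mul_nonneg_right this hl
  obtain ⟨N, θ, hθ0, hθ1, hN, hN1⟩ := exists_natCast_mul_eq hs hl
  have h1 : ∀ x, |F (x + θ * l) - 2 * F x + F (x - θ * l)| ≤ (θ * l + l) * W := by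
    intro x
    have h2 := abs_sub_chord_le hL0 hL hl hF x hθ0 hθ1
    -- The left neighbour `x - θ * l` sits at the fraction `1 - θ` of the interval `[x - l, x]`.
    have h3 := abs_sub_chord_le hL0 hL hl hF (x - l) (sub_nonneg.2 hθ1)
      (sub_le_self _ hθ0)
    have h4 := hF 0 x
    rw [pow_zero, div_one] at h4
    rw [show x - l + (1 - θ) * l = x - θ * l by ring, sub_add_cancel, abs_le] at h3
    have h5 : |θ * (F (x + l) - 2 * F x + F (x - l))| ≤ θ * (l * W) := by
      rw [abs_mul, abs_of_nonneg hθ0]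
      exact mul_le_mul_of_nonneg_left h4 hθ0
    rw [abs_le] at h2 h5 ⊢
    constructor <;> linarith
  have h2 := abs_second_difference_natCast_mul_le h1 N x
  rw [hN] at h2
  refine h2.trans ?_
  rw [← mul_assoc]
  refine mul_le_mul_of_nonneg_right ?_ hW
  have h3 : (N : ℝ) ^ 2 * (θ * l + l) = N * s + N ^ 2 * l := by
    rw [← hN]
    ring
  rw [h3]
  have h4 : (N : ℝ) ^ 2 ≤ (s / l + 1) ^ 2 := pow_le_pow_left₀ (Nat.cast_nonneg N) hN1 2
  have h5 : (s / l + 1) ^ 2 * l = s / l * s + 2 * s + l := by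
    field_simp
    ring
  have h6 := mul_le_mul_of_nonneg_right h4 hl.le
  have h7 := mul_le_mul_of_nonneg_right hN1 hs.le
  linarith

/-- A function close to its chords over intervals of length `l`, with small increments over such
intervals, has small increments over steps of any length `s`. -/
theorem abs_first_difference_le {H : ℝ → ℝ} {D l : ℝ} (hl : 0 < l)
    (hchord : ∀ x θ : ℝ, 0 ≤ θ → θ ≤ 1 →
      |H (x + θ * l) - ((1 - θ) * H x + θ * H (x + l))| ≤ D)
    (hstep : ∀ x, |H (x + l) - H x| ≤ D) {s : ℝ} (hs : 0 < s) (x : ℝ) :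
    |H (x + s) - H x| ≤ (2 * (s / l) + 1) * D := by
  have hD : 0 ≤ D := (abs_nonneg _).trans (hstep 0)
  obtain ⟨N, θ, hθ0, hθ1, hN, hN1⟩ := exists_natCast_mul_eq hs hl
  have h1 : ∀ x, |H (x + θ * l) - H x| ≤ (θ + 1) * D := by
    intro x
    have h2 := hchord x θ hθ0 hθ1
    have h3 : |θ * (H (x + l) - H x)| ≤ θ * D := by
      rw [abs_mul, abs_of_nonneg hθ0]
      exact mul_le_mul_of_nonneg_left (hstep x) hθ0
    rw [abs_le] at h2 h3 ⊢
    constructor <;> linarith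
  have h2 := abs_sub_natCast_mul_le h1 N x
  rw [hN] at h2
  refine h2.trans ?_
  rw [← mul_assoc]
  refine mul_le_mul_of_nonneg_right ?_ hD
  have h3 : (N : ℝ) * θ = s / l := by
    rw [← hN]
    field_simp
  linarith

/-! ### Masses of slices of a column of cubes -/

/-- The mass of the box whose `i`-th side is `[u, v)` and whose other sides are `[p j, p j + l)`. -/
def sliceMass {n : ℕ} (μ : Measure (EuclideanSpace ℝ (Fin n))) (p : Fin n → ℝ) (i : Fin n)
    (l u v : ℝ) : ℝ :=
  μ.real (icoBox (Function.update p i u) (Function.update (fun _ => l) i (v - u)))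

/-- The distribution function, normalised to vanish at `0`, of the mass in the column over the base
`∏ j ≠ i, [p j, p j + l)`. -/
def columnMass {n : ℕ} (μ : Measure (EuclideanSpace ℝ (Fin n))) (p : Fin n → ℝ) (i : Fin n)
    (l x : ℝ) : ℝ :=
  sliceMass μ p i l 0 x - sliceMass μ p i l x 0

section Column

variable {n : ℕ} {μ : Measure (EuclideanSpace ℝ (Fin n))} {p : Fin n → ℝ} {i : Fin n} {l : ℝ}

theorem mem_slice {u v : ℝ} {x : EuclideanSpace ℝ (Fin n)} :
    x ∈ icoBox (Function.update p i u) (Function.update (fun _ => l) i (v - u)) ↔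
      (u ≤ x i ∧ x i < v) ∧ ∀ j ≠ i, p j ≤ x j ∧ x j < p j + l := by
  constructor
  · intro h
    refine ⟨by simpa using h i, fun j hj => by simpa [hj] using h j⟩
  · rintro ⟨h1, h2⟩ j
    by_cases hj : j = i
    · subst hj
      simpa using h1
    · simpa [hj] using h2 j hj

theorem sliceMass_of_le {u v : ℝ} (h : v ≤ u) : sliceMass μ p i l u v = 0 := by
  have : icoBox (Function.update p i u) (Function.update (fun _ => l) i (v - u)) = ∅ := by
    ext x
    simp only [mem_slice, mem_empty_iff_false, iff_false]
    rintro ⟨⟨h1, h2⟩, -⟩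
    linarith
  rw [sliceMass, this, measureReal_empty]

theorem sliceMass_add (hμ : μ ≤ volume) {u v w : ℝ} (huv : u ≤ v) (hvw : v ≤ w) :
    sliceMass μ p i l u v + sliceMass μ p i l v w = sliceMass μ p i l u w := by
  have h1 : icoBox (Function.update p i u) (Function.update (fun _ => l) i (w - u)) =
      icoBox (Function.update p i u) (Function.update (fun _ => l) i (v - u)) ∪
        icoBox (Function.update p i v) (Function.update (fun _ => l) i (w - v)) := by
    ext x
    simp only [mem_slice, mem_union, ← or_and_right]
    refine and_congr_left fun _ => ?_
    constructor
    · rintro ⟨h1, h2⟩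
      rcases lt_or_ge (x i) v with h | h
      · exact Or.inl ⟨h1, h⟩
      · exact Or.inr ⟨h, h2⟩
    · rintro (⟨h1, h2⟩ | ⟨h1, h2⟩) <;> constructor <;> linarith
  rw [sliceMass, sliceMass, sliceMass, h1, measureReal_union _ (measurableSet_icoBox _ _)
    (ne_top_of_le_ne_top (volume_icoBox_ne_top _ _) (hμ _))
    (ne_top_of_le_ne_top (volume_icoBox_ne_top _ _) (hμ _))]
  rw [Set.disjoint_left]
  intro x hx hx'
  rw [mem_slice] at hx hx'
  linarith [hx.1.2, hx'.1.1]

theorem columnMass_sub (hμ : μ ≤ volume) {u v : ℝ} (huv : u ≤ v) :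
    columnMass μ p i l v - columnMass μ p i l u = sliceMass μ p i l u v := by
  unfold columnMass
  rcases le_total 0 u with h | h
  · rw [sliceMass_of_le h, sliceMass_of_le (h.trans huv), ← sliceMass_add hμ h huv]
    ring
  · rcases le_total 0 v with h' | h'
    · rw [sliceMass_of_le h, sliceMass_of_le h', ← sliceMass_add hμ h h']
      ring
    · rw [sliceMass_of_le h, sliceMass_of_le h', ← sliceMass_add hμ huv h']
      ring

theorem sliceMass_nonneg (u v : ℝ) : 0 ≤ sliceMass μ p i l u v :=
  measureReal_nonneg

theorem sliceMass_le (hμ : μ ≤ volume) (hl : 0 < l) {u v : ℝ} (huv : u ≤ v) :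
    sliceMass μ p i l u v ≤ l ^ n / l * (v - u) := by
  refine (ENNReal.toReal_mono (volume_icoBox_ne_top _ _) (hμ _)).trans (le_of_eq ?_)
  rw [← Measure.real, volume_real_slab _ i hl (sub_nonneg.2 huv)]
  ring

theorem abs_columnMass_sub_le (hμ : μ ≤ volume) (hl : 0 < l) (x y : ℝ) :
    |columnMass μ p i l x - columnMass μ p i l y| ≤ l ^ n / l * |x - y| := by
  wlog hxy : y ≤ x generalizing x y
  · rw [abs_sub_comm, abs_sub_comm x]
    exact this y x (le_of_not_ge hxy)
  rw [columnMass_sub hμ hxy, abs_of_nonneg (sliceMass_nonneg _ _),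
    abs_of_nonneg (sub_nonneg.2 hxy)]
  exact sliceMass_le hμ hl hxy

theorem icoBox_eq_gridIndex_preimage (o : Fin n → ℝ) {h : ℝ} (hh : 0 < h) (m : Fin n → ℕ) :
    icoBox o (fun j => h * m j) = gridIndex o h ⁻¹' {z | ∀ j, 0 ≤ z j ∧ z j < m j} := by
  ext x
  simp only [icoBox, gridIndex, mem_preimage, mem_ofPred_eq]
  refine forall_congr' fun j => and_congr ?_ ?_
  · rw [Int.floor_nonneg, le_div_iff₀ hh, zero_mul, sub_nonneg]
  · rw [Int.floor_lt, div_lt_iff₀ hh, Int.cast_natCast, sub_lt_iff_lt_add', mul_comm h]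

/-- Cutting two adjacent slices of thickness `l / 2 ^ k` into cubes of that sidelength compares their
masses with no loss depending on the dimension. -/
theorem abs_columnMass_second_difference_le (hμ : μ ≤ volume) (hl : 0 < l) {w : ℝ}
    (hadj : ∀ s, 0 < s → s ≤ l → AdjacentBound μ s w) (k : ℕ) (x : ℝ) :
    |columnMass μ p i l (x + l / 2 ^ k) - 2 * columnMass μ p i l x +
      columnMass μ p i l (x - l / 2 ^ k)| ≤ l / 2 ^ k * (w * (l ^ n / l)) := by
  set h := l / 2 ^ k with hh
  have hpos : 0 < h := by positivity
  have hle : h ≤ l := div_le_self hl.le (one_le_pow₀ one_le_two)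
  have h1 := columnMass_sub (p := p) (i := i) (l := l) hμ (le_add_of_nonneg_right hpos.le : x ≤ x + h)
  have h2 := columnMass_sub (p := p) (i := i) (l := l) hμ (sub_le_self x hpos.le)
  rw [show columnMass μ p i l (x + h) - 2 * columnMass μ p i l x + columnMass μ p i l (x - h) =
    sliceMass μ p i l x (x + h) - sliceMass μ p i l (x - h) x by rw [← h1, ← h2]; ring]
  -- The slice is a block of `m j` cubes in each direction `j`.
  let m : Fin n → ℕ := Function.update (fun _ => 2 ^ k) i 1
  have hm : Function.update (fun _ => l) i h = fun j => h * m j := by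
    funext j
    by_cases hj : j = i
    · subst hj
      simp [m]
    · simp [m, hj, hh]
  have hcell := abs_measureReal_sub_le_of_cells hμ (Function.update p i x)
    (Function.update p i (x - h)) hpos (Z := {z | ∀ j, 0 ≤ z j ∧ z j < m j}) (ε := w)
    (by
      rw [← icoBox_eq_gridIndex_preimage _ hpos]
      exact volume_icoBox_ne_top _ _)
    (by
      rw [← icoBox_eq_gridIndex_preimage _ hpos]
      exact volume_icoBox_ne_top _ _)
    (fun z _ => by
      rw [gridIndex_preimage_singleton _ hpos, gridIndex_preimage_singleton _ hpos]
      convert hadj h hpos hle (fun j => Function.update p i (x - h) j + h * z j) i using 5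
      funext j
      by_cases hj : j = i
      · subst hj
        simp
        ring
      · simp [hj])
  rw [← icoBox_eq_gridIndex_preimage _ hpos, ← icoBox_eq_gridIndex_preimage _ hpos, ← hm,
    volume_real_slab _ i hl hpos.le] at hcell
  rw [sliceMass, sliceMass, add_sub_cancel_left, sub_sub_cancel]
  refine hcell.trans (le_of_eq ?_)
  ring

/-- Comparison of two slices of arbitrary thickness `s` that are adjacent in the direction `i`. -/
theorem abs_sliceMass_succ_sub_le (hμ : μ ≤ volume) (hl : 0 < l) {w : ℝ}
    (hadj : ∀ s, 0 < s → s ≤ l → AdjacentBound μ s w) {s : ℝ} (hs : 0 < s) (x : ℝ) :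
    |sliceMass μ p i l x (x + s) - sliceMass μ p i l (x - s) x| ≤
      (2 * (s / l) * s + 3 * s + l) * (w * (l ^ n / l)) := by
  have h1 := columnMass_sub (p := p) (i := i) (l := l) hμ (le_add_of_nonneg_right hs.le : x ≤ x + s)
  have h2 := columnMass_sub (p := p) (i := i) (l := l) hμ (sub_le_self x hs.le)
  rw [show sliceMass μ p i l x (x + s) - sliceMass μ p i l (x - s) x =
    columnMass μ p i l (x + s) - 2 * columnMass μ p i l x + columnMass μ p i l (x - s) by
      rw [← h1, ← h2]; ring]
  exact abs_second_difference_le (by positivity) (abs_columnMass_sub_le hμ hl) hl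
    (abs_columnMass_second_difference_le hμ hl hadj) hs x

/-- Comparison of two slices of arbitrary thickness `s` that are adjacent in a direction `j ≠ i`. The
difference `H` of the two distribution functions inherits the chord estimate, and its increments
over steps of length `l` compare adjacent cubes. -/
theorem abs_sliceMass_add_single_sub_le (hμ : μ ≤ volume) (hl : 0 < l) {w : ℝ}
    (hadj : ∀ s, 0 < s → s ≤ l → AdjacentBound μ s w) {j : Fin n} (hj : j ≠ i) {s : ℝ}
    (hs : 0 < s) (x : ℝ) :
    |sliceMass μ (p + Pi.single j l) i l x (x + s) - sliceMass μ p i l x (x + s)| ≤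
      (2 * (s / l) + 1) * (l * (w * (l ^ n / l))) := by
  set q := p + Pi.single j l with hq
  let H : ℝ → ℝ := fun x => columnMass μ q i l x - columnMass μ p i l x
  have hH : ∀ x {s : ℝ}, 0 ≤ s → H (x + s) - H x =
      sliceMass μ q i l x (x + s) - sliceMass μ p i l x (x + s) := by
    intro x s hs
    rw [← columnMass_sub hμ (le_add_of_nonneg_right hs : x ≤ x + s),
      ← columnMass_sub hμ (le_add_of_nonneg_right hs : x ≤ x + s)]
    simp only [H]
    ring
  rw [← hH x hs.le]
  refine abs_first_difference_le hl (fun y θ hθ0 hθ1 => ?_) (fun y => ?_) hs x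
  · have h1 := abs_sub_chord_le (by positivity) (abs_columnMass_sub_le (p := q) (i := i) hμ hl) hl
      (abs_columnMass_second_difference_le hμ hl hadj) y hθ0 hθ1
    have h2 := abs_sub_chord_le (by positivity) (abs_columnMass_sub_le (p := p) (i := i) hμ hl) hl
      (abs_columnMass_second_difference_le hμ hl hadj) y hθ0 hθ1
    simp only [H]
    rw [abs_le] at h1 h2 ⊢
    constructor <;> linarith
  · have h1 := hadj l hl le_rfl (Function.update p i y) j
    have h2 : Function.update p i y + Pi.single j l = Function.update q i y := by
      funext m
      by_cases hm : m = i
      · subst hm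
        simp [hj.symm]
      · simp [hm, hq]
    rw [h2] at h1
    rw [hH y hl.le, sliceMass, sliceMass, add_sub_cancel_left, Function.update_eq_self]
    refine h1.trans (le_of_eq ?_)
    field_simp

end Column

/-! ### Images under dilations -/

section Dilation

variable {n : ℕ} {i : Fin n} {lam : ℝ}

theorem dilation_apply (x : EuclideanSpace ℝ (Fin n)) (j : Fin n) :
    dilation i lam x j = if j = i then lam * x j else x j :=
  rfl

theorem det_dilation_ne_zero (hlam : lam ≠ 0) : LinearMap.det (dilation i lam) ≠ 0 := by
  have h : dilation i lam ∘ₗ dilation i lam⁻¹ = LinearMap.id := by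
    ext x j
    by_cases hj : j = i <;> simp [dilation_apply, hj, hlam]
  have h1 := congrArg LinearMap.det h
  rw [LinearMap.det_comp, LinearMap.det_id] at h1
  exact left_ne_zero_of_mul_eq_one h1

/-- The lower end of the interval of those `x` for which `lam * x ∈ [a, a + l]`. -/
def dilationCorner (lam l a : ℝ) : ℝ :=
  if 0 < lam then a / lam else (a + l) / lam

theorem mem_Icc_dilationCorner (hlam : lam ≠ 0) (l a x : ℝ) :
    a ≤ lam * x ∧ lam * x ≤ a + l ↔
      dilationCorner lam l a ≤ x ∧ x ≤ dilationCorner lam l a + l / |lam| := by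
  rcases hlam.lt_or_gt with h | h
  · rw [dilationCorner, if_neg h.not_gt, abs_of_neg h, div_neg, ← sub_eq_add_neg, ← sub_div,
      add_sub_cancel_right, div_le_iff_of_neg' h, le_div_iff_of_neg' h, and_comm]
  · rw [dilationCorner, if_pos h, abs_of_pos h, ← add_div, div_le_iff₀' h, le_div_iff₀' h]

theorem density_dilation_image (hlam : lam ≠ 0) (A : Set (EuclideanSpace ℝ (Fin n)))
    (a : EuclideanSpace ℝ (Fin n)) {l : ℝ} (hl : 0 < l) :
    density (dilation i lam '' A) (cube a l) =
      sliceMass (volume.restrict A) (fun j => a j) i l (dilationCorner lam l (a i))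
        (dilationCorner lam l (a i) + l / |lam|) / (l / |lam| / l * l ^ n) := by
  set b := dilationCorner lam l (a i) with hb
  have hpre : dilation i lam ⁻¹' cube a l = {x | ∀ j, Function.update (fun j => a j) i b j ≤ x j ∧
      x j ≤ Function.update (fun j => a j) i b j +
        Function.update (fun _ => l) i (l / |lam|) j} := by
    ext x
    simp only [cube, mem_preimage, mem_ofPred_eq]
    refine forall_congr' fun j => ?_
    by_cases hj : j = i
    · subst hj
      simpa [dilation_apply] using mem_Icc_dilationCorner hlam l (a j) (x j)
    · simp [dilation_apply, hj]
  have hae := icoBox_ae_eq_closedBox (Function.update (fun j => a j) i b)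
    (Function.update (fun _ => l) i (l / |lam|))
  rw [density_image_linearMap (det_dilation_ne_zero hlam) A (measurableSet_cube a l), hpre,
    ← measureReal_congr (ae_restrict_of_ae hae), ← measureReal_congr hae,
    volume_real_slab _ i hl (by positivity), sliceMass, add_sub_cancel_left]

theorem abs_density_dilation_image_sub_le (hlam : lam ≠ 0) {A : Set (EuclideanSpace ℝ (Fin n))}
    {l w : ℝ} (hl : 0 < l) (hw : 0 ≤ w)
    (hadj : ∀ s, 0 < s → s ≤ l → AdjacentBound (volume.restrict A) s w)
    {a a' : EuclideanSpace ℝ (Fin n)} {j : Fin n}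
    (haa' : (fun k => a' k) = (fun k => a k) + Pi.single j l) :
    |density (dilation i lam '' A) (cube a' l) - density (dilation i lam '' A) (cube a l)| ≤
      4 * (|lam| + 1 / |lam|) * w := by
  have hμ : volume.restrict A ≤ volume := Measure.restrict_le_self
  have hr : 0 < |lam| := abs_pos.2 hlam
  set s := l / |lam| with hs
  have hspos : 0 < s := by positivity
  have hls : l = |lam| * s := by
    rw [hs]
    field_simp
  have hsl : s / l = 1 / |lam| := by
    rw [hs]
    field_simp
  -- The slack in the factor `4` that makes both bounds below fit under `4 * (|lam| + 1 / |lam|)`.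
  have hlam3 : 3 ≤ 3 * |lam| + 2 * (1 / |lam|) := by
    have h1 : 3 * |lam| + 2 * (1 / |lam|) - 3 = (3 * (|lam| - 1 / 2) ^ 2 + 5 / 4) / |lam| := by
      field_simp
      ring
    rw [← sub_nonneg, h1]
    positivity
  have hden : s / l * l ^ n = s * (l ^ n / l) := by ring
  have hdenpos : 0 < s * (l ^ n / l) := by positivity
  rw [density_dilation_image hlam A a hl, density_dilation_image hlam A a' hl, ← sub_div,
    hden, abs_div, abs_of_pos hdenpos, div_le_iff₀ hdenpos, haa']
  have ha' : a' j = a j + l := by simpa using congrFun haa' j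
  by_cases hj : j = i
  · subst hj
    have hslice : ∀ u v, sliceMass (volume.restrict A) ((fun k => a k) + Pi.single j l) j l u v =
        sliceMass (volume.restrict A) (fun k => a k) j l u v := by
      intro u v
      rw [sliceMass, sliceMass]
      congr 2
      funext k
      by_cases hk : k = j
      · subst hk
        simp
      · simp [hk]
    rw [hslice]
    have hbound : (2 * (s / l) * s + 3 * s + l) * (w * (l ^ n / l)) ≤
        4 * (|lam| + 1 / |lam|) * w * (s * (l ^ n / l)) := by
      have h2 : 2 * (s / l) * s + 3 * s + l ≤ 4 * (|lam| + 1 / |lam|) * s := by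
        have h3 := mul_le_mul_of_nonneg_right hlam3 hspos.le
        rw [hsl]
        linarith
      calc _ ≤ 4 * (|lam| + 1 / |lam|) * s * (w * (l ^ n / l)) :=
            mul_le_mul_of_nonneg_right h2 (by positivity)
        _ = _ := by ring
    refine le_trans ?_ hbound
    rw [ha']
    rcases hlam.lt_or_gt with h | h
    -- A dilation with negative factor reverses the order of the two slices.
    · have hc : dilationCorner lam l (a j + l) = dilationCorner lam l (a j) - s := by
        rw [dilationCorner, dilationCorner, if_neg h.not_gt, if_neg h.not_gt, hs, abs_of_neg h]
        field_simp
        ring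
      rw [hc, sub_add_cancel, abs_sub_comm]
      exact abs_sliceMass_succ_sub_le hμ hl hadj hspos _
    · have hc : dilationCorner lam l (a j) = dilationCorner lam l (a j + l) - s := by
        rw [dilationCorner, dilationCorner, if_pos h, if_pos h, hs, abs_of_pos h]
        field_simp
        ring
      rw [hc, sub_add_cancel]
      exact abs_sliceMass_succ_sub_le hμ hl hadj hspos _
  · have hai : a' i = a i := by simpa [Ne.symm hj] using congrFun haa' i
    rw [hai]
    refine (abs_sliceMass_add_single_sub_le hμ hl hadj hj hspos _).trans ?_
    have h2 : (2 * (s / l) + 1) * l ≤ 4 * (|lam| + 1 / |lam|) * s := by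
      have h3 := mul_le_mul_of_nonneg_right hlam3 hspos.le
      have h4 : (2 * (s / l) + 1) * l = 2 * s + l := by field_simp
      have h5 : 0 ≤ 1 / |lam| * s := by positivity
      linarith
    calc (2 * (s / l) + 1) * (l * (w * (l ^ n / l))) =
          (2 * (s / l) + 1) * l * (w * (l ^ n / l)) := by ring
      _ ≤ 4 * (|lam| + 1 / |lam|) * s * (w * (l ^ n / l)) :=
          mul_le_mul_of_nonneg_right h2 (by positivity)
      _ = _ := by ring

theorem IsOmegaSmooth.image_dilation {ω : ℝ → ℝ} (hω : IsModulus ω)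
    {A : Set (EuclideanSpace ℝ (Fin n))} (hA : IsOmegaSmooth ω A) (hlam : lam ≠ 0) :
    IsOmegaSmooth (fun t => 4 * (|lam| + 1 / |lam|) * ω t) (dilation i lam '' A) := by
  refine ⟨nullMeasurableSet_image_linearMap (det_dilation_ne_zero hlam) hA.1,
    fun l a a' hl hl1 haa' => ?_⟩
  have hw : 0 ≤ ω l := hω.mapsTo ⟨hl.le, hl1⟩
  have hadj : ∀ s, 0 < s → s ≤ l → AdjacentBound (volume.restrict A) s (ω l) :=
    fun s hs hsl => hA.adjacentBound hω hl1 hs hsl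
  obtain ⟨j, h | h⟩ := haa'.exists_eq_add_single hl
  · rw [abs_sub_comm]
    exact abs_density_dilation_image_sub_le hlam hl hw hadj h
  · exact abs_density_dilation_image_sub_le hlam hl hw hadj h

end Dilation

end SmoothSet

end

theorem mainTheorem4 (n : ℕ) :
    (∀ (φ : EuclideanSpace ℝ (Fin n) →ₗ[ℝ] EuclideanSpace ℝ (Fin n))
      (A : Set (EuclideanSpace ℝ (Fin n))),
      SmoothSet.IsSmooth A → SmoothSet.IsSmooth (φ '' A)) ∧
    (∃ C : ℝ, 0 < C ∧
      ∀ φ : EuclideanSpace ℝ (Fin n) →ₗ[ℝ] EuclideanSpace ℝ (Fin n), SmoothSet.IsRotation φ →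
      ∀ ω : ℝ → ℝ, SmoothSet.IsModulus ω →
      ∀ A : Set (EuclideanSpace ℝ (Fin n)), SmoothSet.IsOmegaSmooth ω A →
        SmoothSet.IsOmegaSmooth (fun t => C * ω t) (φ '' A)) ∧
    (∀ (i : Fin n) (lam : ℝ), lam ≠ 0 →
      ∀ ω : ℝ → ℝ, SmoothSet.IsModulus ω →
      ∀ A : Set (EuclideanSpace ℝ (Fin n)), SmoothSet.IsOmegaSmooth ω A →
        SmoothSet.IsOmegaSmooth (fun t => 4 * (|lam| + 1 / |lam|) * ω t)
          (SmoothSet.dilation i lam '' A)) := by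
  refine ⟨fun φ A hA => hA.image_linearMap φ, ⟨SmoothSet.linearConst n 1 1 + 1, ?_, ?_⟩, ?_⟩
  · have := SmoothSet.linearConst_nonneg n zero_le_one zero_le_one
    linarith
  · exact fun φ hφ ω hω A hA => hA.image_rotation hω hφ
  · exact fun i lam hlam ω hω A hA => hA.image_dilation hω hlam
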